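/- Let $[n]=\{1,\dots,n\}$, let $\binom{[n]}{k}$ be the family of all $k$-subsets of $[n]$, and write $[a,b]$ for the set of integers from $a$ to $b$. A family $\mathcal F\subseteq\binom{[n]}{k}$ is \emph{$d$-wise intersecting} if $F_1\cap\dots\cap F_d\neq\emptyset$ for all (not necessarily distinct) $F_1,\dots,F_d\in\mathcal F$, and it is \emph{non-trivial} if no element of $[n]$ lies in all members of $\mathcal F$. A $d$-wise intersecting family $\mathcal F\subseteq\binom{[n]}{k}$ is \emph{maximal} if $\mathcal F\cup\{A\}$ is not $d$-wise intersecting for every $A\in\binom{[n]}{k}\setminus\mathcal F$. Two families are isomorphic, $\mathcal F\cong\mathcal F'$, if some permutation of $[n]$ carries $\mathcal F$ onto $\mathcal F'$. For $k>d\ge 3$ and $2\le l\le k-d+2$ put \[ \begin{aligned} \mathcal H(k,d,l)=&\Big\{F\in\tbinom{[n]}{k}:[d-1]\subseteq F,\ F\cap[d,d+l-1]\neq\emptyset\Big\}\\ &\cup\Big\{F\in\tbinom{[n]}{k}:|[d-1]\cap F|=d-2,\ [d,d+l-1]\subseteq F\Big\}, \end{aligned} \] and \[ n_2(k,d)=\begin{cases}(d+1)^2,&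 k=d+1,\\ d+2(k-d)^2\,(k^{k-d}-1)^k\,k!,& k\ge d+2.\end{cases} \] Theorem. Let $k>d\ge 3$, let $n>n_2(k,d)$, and let $\mathcal F$ be a family of subsets of $[n]$. (1) $\mathcal F$ is a non-trivial $d$-wise intersecting subfamily of $\binom{[n]}{k}$ of the largest size among all such families if and only if $\mathcal F\cong\mathcal H(k,d,2)$ when $k\le 2d-1$, and if and only if $\mathcal F\cong\mathcal H(k,d,k-d+2)$ when $k\ge 2d$. (2) $\mathcal F$ is a maximal non-trivial $d$-wise intersecting subfamily of $\binom{[n]}{k}$ of the second largest size (that is, among all maximal non-trivial $d$-wise intersecting subfamilies of $\binom{[n]}{k}$ there are ones strictly larger than $\mathcal F$, and all of those have the largest size) if and only if $\mathcal F\cong\mathcal H(k,d,k-d+2)$ when $k\le 2d-1$, if and only if $\mathcal F\cong\mathcal H(k,d,2)$ when $k=2d$, and if and only if $\mathcal F\cong\mathcal H(k,d,k-d+1)$ when $k\ge 2d+1$. -/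

import Mathlib

namespace DWise

/-- The interval `[a, b]` in the ground set `[n] = {1, …, n}`; the element `x : Fin n` stands for
the integer `x + 1`. -/
def interval (n a b : ℕ) : Finset (Fin n) :=
  Finset.univ.filter fun x => a ≤ (x : ℕ) + 1 ∧ (x : ℕ) + 1 ≤ b

/-- Every member of the family has exactly `k` elements. -/
def IsUniform {n : ℕ} (k : ℕ) (F : Finset (Finset (Fin n))) : Prop :=
  ∀ A ∈ F, A.card = k

/-- Any `d` members of the family, not necessarily distinct, have a common element. -/
def IsDWiseIntersecting {n : ℕ} (d : ℕ) (F : Finset (Finset (Fin n))) : Prop :=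
  ∀ A : Fin d → Finset (Fin n), (∀ i, A i ∈ F) → ∃ x, ∀ i, x ∈ A i

/-- All members of the family contain a common element. -/
def IsTrivial {n : ℕ} (F : Finset (Finset (Fin n))) : Prop :=
  ∃ x, ∀ A ∈ F, x ∈ A

/-- Non-trivial `d`-wise intersecting `k`-uniform families on `[n]`. -/
def IsNontrivialFamily {n : ℕ} (k d : ℕ) (F : Finset (Finset (Fin n))) : Prop :=
  IsUniform k F ∧ IsDWiseIntersecting d F ∧ ¬ IsTrivial F

/-- Maximal non-trivial `d`-wise intersecting `k`-uniform families on `[n]`: adding any further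
`k`-subset of `[n]` destroys the `d`-wise intersecting property. -/
def IsMaximalNontrivialFamily {n : ℕ} (k d : ℕ) (F : Finset (Finset (Fin n))) : Prop :=
  IsNontrivialFamily k d F ∧
    ∀ A : Finset (Fin n), A.card = k → A ∉ F → ¬ IsDWiseIntersecting d (insert A F)

/-- Two families are isomorphic if a permutation of `[n]` carries one to the other. -/
def Isomorphic {n : ℕ} (F G : Finset (Finset (Fin n))) : Prop :=
  ∃ π : Equiv.Perm (Fin n), (F.image fun A => A.image π) = G

/-- `F` has the largest size among the families with property `P`. -/
def IsLargest {n : ℕ} (P : Finset (Finset (Fin n)) → Prop) (F : Finset (Finset (Fin n))) : Prop :=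
  P F ∧ ∀ G, P G → G.card ≤ F.card

/-- `F` has the second largest size among the families with property `P`: some family with
property `P` is strictly larger than `F`, and every such family has the largest size. -/
def IsSecondLargest {n : ℕ} (P : Finset (Finset (Fin n)) → Prop)
    (F : Finset (Finset (Fin n))) : Prop :=
  P F ∧ (∃ G, P G ∧ F.card < G.card) ∧ ∀ G, P G → F.card < G.card → IsLargest P G

/-- The family `H(k, d, l)` on `[n]`. -/
def H (n k d l : ℕ) : Finset (Finset (Fin n)) :=
  ((Finset.univ.powersetCard k).filter fun F =>
      interval n 1 (d - 1) ⊆ F ∧ (F ∩ interval n d (d + l - 1)).Nonempty) ∪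
    ((Finset.univ.powersetCard k).filter fun F =>
      (interval n 1 (d - 1) ∩ F).card = d - 2 ∧ interval n d (d + l - 1) ⊆ F)

/-- The threshold `n₂(k, d)`, for `k > d`. -/
def n₂ (k d : ℕ) : ℕ :=
  if k = d + 1 then (d + 1) ^ 2
  else d + 2 * (k - d) ^ 2 * (k ^ (k - d) - 1) ^ k * Nat.factorial k

end DWise

/-!
Write `t = d - 1` and `r = k - d`. In a non-trivial `d`-wise intersecting family `G` any `s` members
have at least `d + 1 - s` common elements (`IsNontrivialFamily.card_common`), so in particular `G`
is `t`-intersecting. A *cover* of `G` is a `d`-set that meets every member in at least `d - 1`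
elements. Every `k`-set containing a cover can be added to `G`, so a maximal `G` contains all of
them (`IsMaximalNontrivialFamily.mem_of_cover_subset`), and its covers pairwise share `d - 1`
elements.

Hence the covers either form a sunflower `K ∪ {x}`, `x ∈ X`, with `|K| = d - 1`, or three of them
lie in one `(d + 1)`-set. In the second case `G` is a copy of `H(k, d, 2)`. In the first case, if
`|X| ≥ r + 1`, the members omitting an element of `K` are determined up to one element, and the
`d`-wise intersection property makes every member containing `K` meet `X`, so that `G` is a copy of
`H(k, d, |X|)` with `|X|` equal to `r + 1` or `r + 2`. Therefore a maximal family is a copy of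
`H(k, d, 2)`, `H(k, d, r + 1)` or `H(k, d, r + 2)`, or it has at most `r` covers
(`IsMaximalNontrivialFamily.isomorphic_or_card_covers_le`).

It remains to compare sizes. If `r ≥ 2`, a family with `b` covers has at most
`b * (n - d).choose r + k ^ (d + 1) * (n - d - 1).choose (r - 1)` members, by branching on the
elements of members that a non-cover fails to meet sufficiently (`IsNontrivialFamily.card_le`).
For large `n` the coefficient of `(n - d).choose r` decides; it is `d + 1` for `H(k, d, 2)` and `l`
for `H(k, d, l)` with `l ≥ 3`. The ties, at `k = 2 * d - 1` and `k = 2 * d`, are between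
`H(k, d, 2)` and `H(k, d, d + 1)`, and the exact sizes settle them (`card_H_lt_card_H_two`). If `r = 1`, the
families with at most one cover are bounded directly, using that a `d`-set that is not a cover lies
in at most three members.
-/

namespace DWise

open Finset

variable {n : ℕ}

/-! ### Finite set preliminaries -/

theorem exists_superset_disjoint {k : ℕ} (T Z : Finset (Fin n)) (hT : T.card ≤ k)
    (hZ : Z.card + k ≤ n) : ∃ S, T ⊆ S ∧ S.card = k ∧ Disjoint (S \ T) Z := by
  have h : k ≤ (T ∪ Zᶜ).card := by
    have h1 : Zᶜ.card ≤ (T ∪ Zᶜ).card := card_le_card subset_union_right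
    have h2 := card_compl_add_card Z
    rw [Fintype.card_fin] at h2
    omega
  obtain ⟨S, h1, h2, h3⟩ := exists_subsuperset_card_eq (subset_union_left (s₂ := Zᶜ)) hT h
  refine ⟨S, h1, h3, ?_⟩
  rw [disjoint_left]
  intro a ha haZ
  rw [mem_sdiff] at ha
  have := h2 ha.1
  simp only [mem_union, mem_compl] at this
  tauto

/-- The number of `k`-sets with a prescribed trace `S` on a set `Y`. -/
theorem card_filter_inter_eq {k : ℕ} {Y S : Finset (Fin n)} (hS : S ⊆ Y) (hk : S.card ≤ k) :
    ((univ.powersetCard k).filter fun F : Finset (Fin n) => F ∩ Y = S).card =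
      (n - Y.card).choose (k - S.card) := by
  have hc : (powersetCard (k - S.card) Yᶜ).card = (n - Y.card).choose (k - S.card) := by
    rw [card_powersetCard, card_compl, Fintype.card_fin]
  rw [← hc]
  refine card_nbij' (fun F => F \ Y) (fun G => S ∪ G) ?_ ?_ ?_ ?_
  · intro F hF
    simp only [coe_filter, mem_powersetCard, subset_univ, true_and, Set.mem_ofPred_eq] at hF
    simp only [mem_coe, mem_powersetCard]
    refine ⟨fun x hx => ?_, ?_⟩
    · rw [mem_compl]; exact (mem_sdiff.1 hx).2
    · have := card_sdiff_add_card_inter F Y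
      rw [hF.2] at this
      omega
  · intro G hG
    simp only [mem_coe, mem_powersetCard] at hG
    have hd : Disjoint Y G := by
      rw [disjoint_left]
      intro a h1 h2
      exact (mem_compl.1 (hG.1 h2)) h1
    simp only [coe_filter, mem_powersetCard, subset_univ, true_and, Set.mem_ofPred_eq]
    constructor
    · rw [card_union_of_disjoint (disjoint_of_subset_left hS hd)]; omega
    · rw [union_inter_distrib_right, inter_eq_left.2 hS, inter_comm,
        disjoint_iff_inter_eq_empty.1 hd, union_empty]
  · intro F hF
    simp only [coe_filter, mem_powersetCard, subset_univ, true_and, Set.mem_ofPred_eq] at hF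
    simp only
    rw [← hF.2]
    ext x; simp only [mem_union, mem_inter, mem_sdiff]; tauto
  · intro G hG
    simp only [mem_coe, mem_powersetCard] at hG
    ext x
    simp only [mem_sdiff, mem_union]
    constructor
    · rintro ⟨h1 | h1, h2⟩
      · exact absurd (hS h1) h2
      · exact h1
    · intro h
      exact ⟨Or.inr h, mem_compl.1 (hG.1 h)⟩

theorem card_filter_superset {k : ℕ} {T : Finset (Fin n)} (hk : T.card ≤ k) :
    ((univ.powersetCard k).filter fun F : Finset (Fin n) => T ⊆ F).card =
      (n - T.card).choose (k - T.card) := by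
  rw [← card_filter_inter_eq (Subset.refl T) hk]
  congr 1
  ext F
  simp only [mem_filter, inter_eq_right]

/-- A permutation of the ground set carrying one pair of disjoint sets onto another pair of the
same sizes. -/
theorem exists_perm_image_eq {K X K' X' : Finset (Fin n)} (h : Disjoint K X)
    (h' : Disjoint K' X') (hK : K.card = K'.card) (hX : X.card = X'.card) :
    ∃ π : Equiv.Perm (Fin n), K.image π = K' ∧ X.image π = X' := by
  let f : Finset (Fin n) → Finset (Fin n) → Fin n → Fin 3 := fun K X x =>
    if x ∈ K then 0 else if x ∈ X then 1 else 2
  have f0 : ∀ K X x, f K X x = 0 ↔ x ∈ K := by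
    intro K X x; simp only [f]; split_ifs <;> simp_all
  have f1 : ∀ K X, Disjoint K X → ∀ x, f K X x = 1 ↔ x ∈ X := by
    intro K X h x; simp only [f]
    have : x ∈ K → x ∉ X := fun hx => disjoint_left.1 h hx
    split_ifs <;> simp_all
  have f2 : ∀ K X x, f K X x = 2 ↔ x ∈ (K ∪ X)ᶜ := by
    intro K X x; simp only [f]; split_ifs <;> simp_all
  have e : ∀ c, Nonempty ({a // f K X a = c} ≃ {a // f K' X' a = c}) := by
    intro c
    rw [← Fintype.card_eq]
    fin_cases c
    · simp only [Fin.zero_eta, f0, Fintype.card_coe, hK]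
    · simp only [Fin.mk_one, f1 _ _ h, f1 _ _ h', Fintype.card_coe, hX]
    · simp only [Fin.reduceFinMk, f2, Fintype.card_coe, card_compl, card_union_of_disjoint h,
        card_union_of_disjoint h', hK, hX]
  let π : Equiv.Perm (Fin n) := Equiv.ofFiberEquiv fun c => (e c).some
  have hπ : ∀ a, f K' X' (π a) = f K X a := fun a => Equiv.ofFiberEquiv_map _ a
  have key : ∀ A B : Finset (Fin n), (∀ a, π a ∈ B ↔ a ∈ A) → A.image π = B := by
    intro A B hAB
    ext b
    rw [mem_image]
    constructor
    · rintro ⟨a, ha, rfl⟩; exact (hAB _).2 ha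
    · intro hb
      exact ⟨π.symm b, (hAB _).1 (by simpa using hb), by simp⟩
  refine ⟨π, key _ _ fun a => ?_, key _ _ fun a => ?_⟩
  · rw [← f0 K' X', ← f0 K X, hπ]
  · rw [← f1 K' X' h', ← f1 K X h, hπ]

theorem card_interval {a b : ℕ} (ha : 1 ≤ a) (hb : b ≤ n) :
    (interval n a b).card = b + 1 - a := by
  have : (interval n a b).map Fin.valEmbedding = Finset.Ico (a - 1) b := by
    ext x
    simp only [interval, mem_map, mem_filter, mem_univ, true_and, Fin.valEmbedding_apply, mem_Ico]
    constructor
    · rintro ⟨y, h, rfl⟩; omega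
    · intro h
      exact ⟨⟨x, by omega⟩, by simp only; omega, rfl⟩
  rw [← card_map Fin.valEmbedding, this, Nat.card_Ico]
  omega

/-! ### Isomorphic families -/

theorem Isomorphic.card_eq {F G : Finset (Finset (Fin n))} (h : Isomorphic F G) :
    F.card = G.card := by
  obtain ⟨π, rfl⟩ := h
  exact (card_image_of_injective _ (image_injective π.injective)).symm

theorem Isomorphic.symm {F G : Finset (Finset (Fin n))} (h : Isomorphic F G) :
    Isomorphic G F := by
  obtain ⟨π, rfl⟩ := h
  refine ⟨π.symm, ?_⟩
  have : (F.image ((fun A : Finset (Fin n) => A.image π.symm) ∘ fun A => A.image π)) =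
      F.image id := by
    congr 1
    ext A x
    simp [image_image]
  rw [image_image, this, image_id]

theorem image_symm_image (π : Equiv.Perm (Fin n)) (A : Finset (Fin n)) :
    (A.image π.symm).image π = A := by
  simp [image_image]

theorem IsDWiseIntersecting.map {d : ℕ} {F : Finset (Finset (Fin n))}
    (h : IsDWiseIntersecting d F) (π : Equiv.Perm (Fin n)) :
    IsDWiseIntersecting d (F.image fun A => A.image π) := by
  intro A hA
  have hA' : ∀ i, (A i).image π.symm ∈ F := by
    intro i
    obtain ⟨B, hB, hBA⟩ := mem_image.1 (hA i)
    rw [← hBA]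
    simpa [image_image] using hB
  obtain ⟨x, hx⟩ := h _ hA'
  refine ⟨π x, fun i => ?_⟩
  obtain ⟨y, hy, hyx⟩ := mem_image.1 (hx i)
  rw [← hyx]
  simpa using hy

theorem IsMaximalNontrivialFamily.map {k d : ℕ} {F : Finset (Finset (Fin n))}
    (h : IsMaximalNontrivialFamily k d F) (π : Equiv.Perm (Fin n)) :
    IsMaximalNontrivialFamily k d (F.image fun A => A.image π) := by
  obtain ⟨⟨h1, h2, h3⟩, h4⟩ := h
  refine ⟨⟨?_, h2.map π, ?_⟩, ?_⟩
  · intro A hA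
    obtain ⟨B, hB, rfl⟩ := mem_image.1 hA
    rw [card_image_of_injective _ π.injective]
    exact h1 B hB
  · rintro ⟨x, hx⟩
    refine h3 ⟨π.symm x, fun A hA => ?_⟩
    obtain ⟨y, hy, hyx⟩ := mem_image.1 (hx _ (mem_image_of_mem _ hA))
    rw [← hyx]
    simpa using hy
  · intro A hA hAF hd
    refine h4 (A.image π.symm) (by rwa [card_image_of_injective _ π.symm.injective]) ?_ ?_
    · intro hmem
      apply hAF
      have := mem_image_of_mem (fun A : Finset (Fin n) => A.image π) hmem
      simpa only [image_symm_image] using this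
    · have := hd.map π.symm
      rw [image_insert, image_image] at this
      convert this
      have : (F.image ((fun A : Finset (Fin n) => A.image π.symm) ∘ fun A => A.image π)) =
          F.image id := by
        congr 1
        ext A x
        simp [image_image]
      rw [this, image_id]

theorem Isomorphic.isMaximalNontrivialFamily {k d : ℕ} {F G : Finset (Finset (Fin n))}
    (h : Isomorphic F G) (hF : IsMaximalNontrivialFamily k d F) :
    IsMaximalNontrivialFamily k d G := by
  obtain ⟨π, rfl⟩ := h
  exact hF.map π

/-! ### Largest and second largest families -/

theorem IsNontrivialFamily.exists_maximal_superset {k d : ℕ} {F : Finset (Finset (Fin n))}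
    (hF : IsNontrivialFamily k d F) :
    ∃ G, IsMaximalNontrivialFamily k d G ∧ F ⊆ G := by
  obtain ⟨G, hFG, hG⟩ := (Set.toFinite {G | IsNontrivialFamily k d G}).exists_le_maximal hF
  refine ⟨G, ⟨hG.1, ?_⟩, hFG⟩
  intro A hA hAG hd
  have : IsNontrivialFamily k d (insert A G) := by
    refine ⟨?_, hd, ?_⟩
    · intro B hB
      rcases mem_insert.1 hB with rfl | hB
      · exact hA
      · exact hG.1.1 B hB
    · rintro ⟨x, hx⟩
      exact hG.1.2.2 ⟨x, fun B hB => hx B (mem_insert_of_mem hB)⟩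
  exact hAG (hG.2 this (subset_insert A G) (mem_insert_self A G))

/-- If every maximal family is a copy of `Ha`, a copy of the smaller family `Hb`, or smaller than
both, then `Ha` and `Hb` are the unique largest and second largest families. -/
theorem largest_and_secondLargest {k d : ℕ} {Ha Hb : Finset (Finset (Fin n))}
    (ha : IsMaximalNontrivialFamily k d Ha) (hb : IsMaximalNontrivialFamily k d Hb)
    (hab : Hb.card < Ha.card)
    (h : ∀ G, IsMaximalNontrivialFamily k d G →
      Isomorphic G Ha ∨ Isomorphic G Hb ∨ G.card < Hb.card) (F : Finset (Finset (Fin n))) :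
    (IsLargest (IsNontrivialFamily k d) F ↔ Isomorphic F Ha) ∧
    (IsSecondLargest (IsMaximalNontrivialFamily k d) F ↔ Isomorphic F Hb) := by
  have hle : ∀ G : Finset (Finset (Fin n)), IsMaximalNontrivialFamily k d G → G.card ≤ Ha.card := by
    intro G hG
    rcases h G hG with h | h | h
    · exact h.card_eq.le
    · rw [h.card_eq]; exact hab.le
    · omega
  refine ⟨⟨?_, ?_⟩, ⟨?_, ?_⟩⟩
  · rintro ⟨h1, h2⟩
    obtain ⟨G, hG, hFG⟩ := h1.exists_maximal_superset
    have hFe : F = G := eq_of_subset_of_card_le hFG (h2 G hG.1)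
    subst hFe
    have := h2 Ha ha.1
    rcases h F hG with h | h | h
    · exact h
    · have := h.card_eq; omega
    · omega
  · intro hF
    refine ⟨(hF.symm.isMaximalNontrivialFamily ha).1, fun G hG => ?_⟩
    obtain ⟨G', hG', hGG⟩ := hG.exists_maximal_superset
    rw [hF.card_eq]
    exact (card_le_card hGG).trans (hle G' hG')
  · rintro ⟨h1, ⟨G, hG, hFG⟩, h3⟩
    rcases h F h1 with h | h | h
    · have := hle G hG
      have := h.card_eq
      omega
    · exact h
    · have := (h3 Hb hb h).2 Ha ha
      omega
  · intro hF
    refine ⟨hF.symm.isMaximalNontrivialFamily hb, ⟨Ha, ha, by rw [hF.card_eq]; exact hab⟩, ?_⟩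
    intro G hG hFG
    rw [hF.card_eq] at hFG
    refine ⟨hG, fun G' hG' => ?_⟩
    rcases h G hG with h | h | h
    · rw [h.card_eq]; exact hle G' hG'
    · have := h.card_eq; omega
    · omega

variable {k d : ℕ} {G : Finset (Finset (Fin n))}

/-! ### Intersections and covers -/

theorem IsDWiseIntersecting.exists_mem (h : IsDWiseIntersecting d G)
    {S : Finset (Finset (Fin n))} (hS : S ⊆ G) (hne : S.Nonempty) (hc : S.card ≤ d) :
    ∃ x, ∀ A ∈ S, x ∈ A := by
  obtain ⟨e⟩ : Nonempty (S ↪ Fin d) :=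
    Function.Embedding.nonempty_of_card_le (by simpa using hc)
  have : Nonempty S := hne.to_subtype
  obtain ⟨x, hx⟩ := h (fun i => (Function.invFun e i : S)) fun i => hS (Subtype.property _)
  refine ⟨x, fun A hA => ?_⟩
  have := hx (e ⟨A, hA⟩)
  rwa [Function.leftInverse_invFun e.injective] at this

theorem IsNontrivialFamily.exists_notMem (hG : IsNontrivialFamily k d G) (x : Fin n) :
    ∃ A ∈ G, x ∉ A := by
  by_contra! h
  exact hG.2.2 ⟨x, h⟩

/-- In a non-trivial `d`-wise intersecting family any `s` members have at least `d + 1 - s`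
common elements: otherwise members avoiding each of these could be added to them. -/
theorem IsNontrivialFamily.card_common (hG : IsNontrivialFamily k d G)
    {S : Finset (Finset (Fin n))} (hS : S ⊆ G) (hne : S.Nonempty) :
    d + 1 ≤ (univ.filter fun x => ∀ A ∈ S, x ∈ A).card + S.card := by
  by_contra! hlt
  choose A hA hxA using hG.exists_notMem
  set I := univ.filter fun x => ∀ A ∈ S, x ∈ A with hI
  have hsub : S ∪ I.image A ⊆ G := by
    refine union_subset hS fun B hB => ?_
    obtain ⟨x, -, rfl⟩ := mem_image.1 hB
    exact hA x
  obtain ⟨x, hx⟩ := hG.2.1.exists_mem hsub (hne.mono subset_union_left) (by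
    have h1 := card_union_le S (I.image A)
    have h2 := card_image_le (s := I) (f := A)
    omega)
  have hxI : x ∈ I := by
    rw [hI, mem_filter]
    exact ⟨mem_univ x, fun B hB => hx B (mem_union_left _ hB)⟩
  exact hxA x (hx _ (mem_union_right _ (mem_image_of_mem A hxI)))

theorem IsNontrivialFamily.card_inter (hG : IsNontrivialFamily k d G) {A B : Finset (Fin n)}
    (hA : A ∈ G) (hB : B ∈ G) : d ≤ (A ∩ B).card + 1 := by
  have h := hG.card_common (S := {A, B}) (by simp [insert_subset_iff, hA, hB]) (by simp)
  have h2 : (({A, B} : Finset (Finset (Fin n)))).card ≤ 2 := card_le_two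
  have h3 : (univ.filter fun x => ∀ C ∈ ({A, B} : Finset (Finset (Fin n))), x ∈ C) = A ∩ B := by
    ext x; simp
  rw [h3] at h
  omega

theorem IsNontrivialFamily.card_inter_inter (hG : IsNontrivialFamily k d G)
    {A B C : Finset (Fin n)} (hA : A ∈ G) (hB : B ∈ G) (hC : C ∈ G) :
    d ≤ (A ∩ B ∩ C).card + 2 := by
  have h := hG.card_common (S := {A, B, C}) (by simp [insert_subset_iff, hA, hB, hC]) (by simp)
  have h2 : (({A, B, C} : Finset (Finset (Fin n)))).card ≤ 3 := card_le_three
  have h3 : (univ.filter fun x => ∀ D ∈ ({A, B, C} : Finset (Finset (Fin n))), x ∈ D) =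
      A ∩ B ∩ C := by
    ext x; simp
  rw [h3] at h
  omega

/-- A cover of `G` is a `d`-set that meets every member of `G` in at least `d - 1` elements. -/
def covers (d : ℕ) (G : Finset (Finset (Fin n))) : Finset (Finset (Fin n)) :=
  (univ.powersetCard d).filter fun T => ∀ A ∈ G, d ≤ (T ∩ A).card + 1

theorem mem_covers {T : Finset (Fin n)} :
    T ∈ covers d G ↔ T.card = d ∧ ∀ A ∈ G, d ≤ (T ∩ A).card + 1 := by
  simp [covers, mem_powersetCard]

/-- A member of the family omits at most one element of a cover. -/
theorem eq_of_mem_covers {T A : Finset (Fin n)} (hT : T ∈ covers d G) (hA : A ∈ G)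
    {x y : Fin n} (hx : x ∈ T) (hy : y ∈ T) (hxA : x ∉ A) (hyA : y ∉ A) : x = y := by
  rw [mem_covers] at hT
  have h1 := card_sdiff_add_card_inter T A
  have h2 := hT.2 A hA
  have h3 : (T \ A).card ≤ 1 := by omega
  exact card_le_one.1 h3 x (mem_sdiff.2 ⟨hx, hxA⟩) y (mem_sdiff.2 ⟨hy, hyA⟩)

theorem IsMaximalNontrivialFamily.mem_of_insert (hG : IsMaximalNontrivialFamily k d G)
    {S : Finset (Fin n)} (hS : S.card = k) (h : IsDWiseIntersecting d (insert S G)) : S ∈ G := by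
  by_contra hSG
  exact hG.2 S hS hSG h

/-- A maximal family contains every `k`-set that contains a cover `T`: any `d - 1` members omit
together at most `d - 1` elements of `T`. -/
theorem IsMaximalNontrivialFamily.mem_of_cover_subset (hG : IsMaximalNontrivialFamily k d G)
    {T S : Finset (Fin n)} (hT : T ∈ covers d G) (hTS : T ⊆ S) (hS : S.card = k) : S ∈ G := by
  refine hG.mem_of_insert hS fun A hA => ?_
  by_cases hall : ∀ i, A i ∈ G
  · exact hG.1.2.1 A hall
  push Not at hall
  obtain ⟨i, hi⟩ := hall
  have hiS : A i = S := (mem_insert.1 (hA i)).resolve_right hi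
  by_contra! hno
  have hch : ∀ x, ∃ j, x ∉ A j := hno
  choose f hf using hch
  have hfS : ∀ x ∈ T, A (f x) ∈ G := by
    intro x hx
    refine (mem_insert.1 (hA (f x))).resolve_left fun h => ?_
    exact hf x (h ▸ hTS hx)
  have hd : (univ.erase i).card < T.card := by
    rw [card_erase_of_mem (mem_univ i), card_univ, Fintype.card_fin, (mem_covers.1 hT).1]
    have := i.pos
    omega
  obtain ⟨x, hx, y, hy, hxy, hfxy⟩ :=
    exists_ne_map_eq_of_card_lt_of_maps_to hd (f := f) (by
      intro x hx
      simp only [coe_erase, coe_univ, Set.mem_sdiff, Set.mem_univ, Set.mem_singleton_iff, true_and]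
      intro hfi
      exact hi (hfi ▸ hfS x hx))
  exact hxy (eq_of_mem_covers hT (hfS x hx) hx hy (hf x) (hfxy ▸ hf y))

theorem IsMaximalNontrivialFamily.card_inter_covers (hG : IsMaximalNontrivialFamily k d G)
    (hdk : d ≤ k) (hn : d + k ≤ n) {T T' : Finset (Fin n)} (hT : T ∈ covers d G)
    (hT' : T' ∈ covers d G) : d ≤ (T ∩ T').card + 1 := by
  obtain ⟨S, h1, h2, h3⟩ := exists_superset_disjoint (k := k) T' T
    (by rw [(mem_covers.1 hT').1]; exact hdk) (by rw [(mem_covers.1 hT).1]; exact hn)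
  have hle := (mem_covers.1 hT).2 S (hG.mem_of_cover_subset hT' h1 h2)
  have : T ∩ S = T ∩ T' := by
    ext x
    simp only [mem_inter, and_congr_right_iff]
    intro hx
    refine ⟨fun hxS => ?_, fun h => h1 h⟩
    by_contra hxT
    exact disjoint_left.1 h3 (mem_sdiff.2 ⟨hxS, hxT⟩) hx
  rwa [this] at hle

/-! ### The families with kernel `K` and petals `X` -/

/-- The family of the `k`-sets that contain `K` and meet `X`, or contain `X` and all but one
element of `K`. It is the coordinate-free form of `H n k d l`, where `K` and `X` are disjoint of
sizes `d - 1` and `l`. -/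
def hFamily (k : ℕ) (K X : Finset (Fin n)) : Finset (Finset (Fin n)) :=
  (univ.powersetCard k).filter fun F =>
    (K ⊆ F ∧ (F ∩ X).Nonempty) ∨ ((K ∩ F).card + 1 = K.card ∧ X ⊆ F)

theorem mem_hFamily {K X F : Finset (Fin n)} :
    F ∈ hFamily k K X ↔ F.card = k ∧
      ((K ⊆ F ∧ (F ∩ X).Nonempty) ∨ ((K ∩ F).card + 1 = K.card ∧ X ⊆ F)) := by
  simp [hFamily, mem_powersetCard]

theorem image_hFamily (K X : Finset (Fin n)) (π : Equiv.Perm (Fin n)) :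
    ((hFamily k K X).image fun A => A.image π) = hFamily k (K.image π) (X.image π) := by
  have key : ∀ (K X A : Finset (Fin n)) (π : Equiv.Perm (Fin n)), A ∈ hFamily k K X →
      A.image π ∈ hFamily k (K.image π) (X.image π) := by
    intro K X A π hA
    rw [mem_hFamily] at hA ⊢
    rw [card_image_of_injective _ π.injective, ← image_inter _ _ π.injective,
      ← image_inter _ _ π.injective, card_image_of_injective _ π.injective,
      card_image_of_injective _ π.injective, image_nonempty,
      image_subset_image_iff π.injective, image_subset_image_iff π.injective]
    exact hA
  ext A
  rw [mem_image]
  constructor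
  · rintro ⟨B, hB, rfl⟩
    exact key K X B π hB
  · intro hA
    refine ⟨A.image π.symm, ?_, image_symm_image π A⟩
    have := key _ _ _ π.symm hA
    simpa [image_image] using this

theorem isomorphic_hFamily {K X K' X' : Finset (Fin n)} (h : Disjoint K X)
    (h' : Disjoint K' X') (hK : K.card = K'.card) (hX : X.card = X'.card) :
    Isomorphic (hFamily k K X) (hFamily k K' X') := by
  obtain ⟨π, rfl, rfl⟩ := exists_perm_image_eq h h' hK hX
  exact ⟨π, image_hFamily K X π⟩

theorem H_eq_hFamily (hd : 3 ≤ d) (hn : d ≤ n) (l : ℕ) :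
    H n k d l = hFamily k (interval n 1 (d - 1)) (interval n d (d + l - 1)) := by
  have hc : (interval n 1 (d - 1)).card = d - 1 := by
    rw [card_interval le_rfl (by omega)]; omega
  ext F
  simp only [H, hFamily, mem_union, mem_filter, hc]
  have : (interval n 1 (d - 1) ∩ F).card + 1 = d - 1 ↔
      (interval n 1 (d - 1) ∩ F).card = d - 2 := by omega
  rw [this]
  tauto

theorem disjoint_interval (a b c e : ℕ) (h : b < c) :
    Disjoint (interval n a b) (interval n c e) := by
  rw [disjoint_left]
  intro x h1 h2
  simp only [interval, mem_filter, mem_univ, true_and] at h1 h2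
  omega

theorem isomorphic_H {K X : Finset (Fin n)} {l : ℕ} (hd : 3 ≤ d) (hn : d + l ≤ n + 1)
    (hl : 1 ≤ l) (h : Disjoint K X) (hK : K.card + 1 = d) (hX : X.card = l) :
    Isomorphic (hFamily k K X) (H n k d l) := by
  rw [H_eq_hFamily hd (by omega)]
  refine isomorphic_hFamily h (disjoint_interval _ _ _ _ (by omega)) ?_ ?_
  · rw [card_interval le_rfl (by omega)]; omega
  · rw [card_interval (by omega) (by omega)]; omega

/-- If the `d` sets have no common element in `K`, then at least `d - 1` of them contain `X`, and
the remaining one meets `X`. -/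
theorem isDWiseIntersecting_hFamily {K X : Finset (Fin n)} (hK : K.card + 1 = d)
    (hX : X.Nonempty) : IsDWiseIntersecting d (hFamily k K X) := by
  intro A hA
  by_contra! hno
  choose f hf using hno
  have hA' := fun i => (mem_hFamily.1 (hA i)).2
  have hsub : ∀ x ∈ K, X ⊆ A (f x) := by
    intro x hx
    rcases hA' (f x) with h | h
    · exact absurd (h.1 hx) (hf x)
    · exact h.2
  have hinj : Set.InjOn f K := by
    intro x hx y hy hxy
    rcases hA' (f x) with h | h
    · exact absurd (h.1 hx) (hf x)
    · have h1 := card_sdiff_add_card_inter K (A (f x))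
      have h3 : (K \ A (f x)).card ≤ 1 := by omega
      exact card_le_one.1 h3 x (mem_sdiff.2 ⟨hx, hf x⟩) y (mem_sdiff.2 ⟨hy, hxy ▸ hf y⟩)
  have hcard : (K.image f).card = K.card := card_image_of_injOn hinj
  by_cases hj : ∃ j, ¬ X ⊆ A j
  · obtain ⟨j, hj⟩ := hj
    have himg : K.image f = univ.erase j := by
      refine eq_of_subset_of_card_le ?_ ?_
      · intro i hi
        obtain ⟨x, hx, rfl⟩ := mem_image.1 hi
        refine mem_erase.2 ⟨fun h => hj (h ▸ hsub x hx), mem_univ _⟩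
      · rw [hcard, card_erase_of_mem (mem_univ j), card_univ, Fintype.card_fin]
        omega
    rcases hA' j with h | h
    · obtain ⟨x, hx⟩ := h.2
      rw [mem_inter] at hx
      have hne : f x ≠ j := fun h => hf x (h ▸ hx.1)
      have : f x ∈ K.image f := by rw [himg]; exact mem_erase.2 ⟨hne, mem_univ _⟩
      obtain ⟨y, hy, hyx⟩ := mem_image.1 this
      exact hf x (hyx ▸ hsub y hy hx.2)
    · exact hj h.2
  · push Not at hj
    obtain ⟨x, hx⟩ := hX
    exact hf x (hj _ hx)

/-- Membership in `hFamily` of sets omitting exactly one prescribed element of `K`. -/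
theorem mem_hFamily_of_erase_subset {K X F : Finset (Fin n)} (hF : F.card = k) {y : Fin n}
    (hy : y ∈ K) (hyF : y ∉ F) (h : K.erase y ⊆ F) (hX : X ⊆ F) : F ∈ hFamily k K X := by
  refine mem_hFamily.2 ⟨hF, Or.inr ⟨?_, hX⟩⟩
  have : K ∩ F = K.erase y := by
    ext x
    rw [mem_inter, mem_erase]
    refine ⟨fun hx => ⟨fun h => hyF (h ▸ hx.2), hx.1⟩, fun hx => ⟨hx.2, h (mem_erase.2 hx)⟩⟩
  rw [this, card_erase_add_one hy]

/-- For each `y ∈ K` there are members omitting `y` and avoiding a given set outside `K ∪ X`. -/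
theorem exists_mem_hFamily_erase {K X : Finset (Fin n)} (hKX : Disjoint K X) {y : Fin n}
    (hy : y ∈ K) (hk : K.card + X.card ≤ k + 1) {Z : Finset (Fin n)}
    (hZ : Z.card + 1 + k ≤ n) :
    ∃ F ∈ hFamily k K X, y ∉ F ∧ Disjoint (F \ (K ∪ X)) Z := by
  have hc : (K.erase y ∪ X).card ≤ k := by
    have h1 := card_union_le (K.erase y) X
    have h2 := card_erase_add_one hy
    omega
  obtain ⟨S, h1, h2, h3⟩ := exists_superset_disjoint (K.erase y ∪ X) (insert y Z) hc (by
    have := card_insert_le y Z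
    omega)
  have hyT : y ∉ K.erase y ∪ X := by
    rw [mem_union, mem_erase]
    rintro (h | h)
    · exact h.1 rfl
    · exact disjoint_left.1 hKX hy h
  have hyS : y ∉ S := fun h => disjoint_left.1 h3 (mem_sdiff.2 ⟨h, hyT⟩) (mem_insert_self y Z)
  refine ⟨S, mem_hFamily_of_erase_subset h2 hy hyS (subset_union_left.trans h1)
    (subset_union_right.trans h1), hyS, ?_⟩
  rw [disjoint_left] at h3 ⊢
  intro a ha haZ
  rw [mem_sdiff, mem_union] at ha
  refine h3 (mem_sdiff.2 ⟨ha.1, fun h => ?_⟩) (mem_insert_of_mem haZ)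
  rw [mem_union, mem_erase] at h
  tauto

theorem isNontrivialFamily_hFamily {K X : Finset (Fin n)} (hKX : Disjoint K X) (hd : 3 ≤ d)
    (hK : K.card + 1 = d) (hX : 2 ≤ X.card) (hk : K.card + X.card ≤ k + 1) (hdk : d ≤ k)
    (hn : k + d ≤ n) : IsNontrivialFamily k d (hFamily k K X) := by
  have hXne : X.Nonempty := card_pos.1 (by omega)
  refine ⟨fun A hA => (mem_hFamily.1 hA).1, isDWiseIntersecting_hFamily hK hXne, ?_⟩
  rintro ⟨x, hx⟩
  by_cases hxK : x ∈ K
  · obtain ⟨F, hF, hxF, -⟩ := exists_mem_hFamily_erase hKX hxK hk (Z := ∅) (by simp; omega)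
    exact hxF (hx F hF)
  · obtain ⟨z, hz, hzx⟩ := exists_mem_ne (by omega : 1 < X.card) x
    obtain ⟨S, h1, h2, h3⟩ := exists_superset_disjoint (k := k) (insert z K) {x}
      ((card_insert_le _ _).trans (by omega)) (by rw [card_singleton]; omega)
    have : S ∈ hFamily k K X := mem_hFamily.2 ⟨h2, Or.inl ⟨(subset_insert _ _).trans h1,
      z, mem_inter.2 ⟨h1 (mem_insert_self _ _), hz⟩⟩⟩
    refine disjoint_left.1 h3 (mem_sdiff.2 ⟨hx S this, ?_⟩) (mem_singleton_self x)
    rw [mem_insert]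
    rintro (h | h)
    · exact hzx h.symm
    · exact hxK h

/-- A set that can be added to `hFamily` omits at most one element of each set `K ∪ {x}`, `x ∈ X`;
if it contains `K`, then it meets `X` since it shares an element with `d - 1` members that omit
the different elements of `K` and meet it only inside `K ∪ X`. -/
theorem isMaximalNontrivialFamily_hFamily {K X : Finset (Fin n)} (hKX : Disjoint K X)
    (hd : 3 ≤ d) (hK : K.card + 1 = d) (hX : 2 ≤ X.card) (hk : K.card + X.card ≤ k + 1)
    (hdk : d ≤ k) (hn : 2 * k + 1 ≤ n) : IsMaximalNontrivialFamily k d (hFamily k K X) := by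
  have hnt := isNontrivialFamily_hFamily hKX hd hK hX hk hdk (by omega)
  refine ⟨hnt, fun A hA hAH hdw => hAH (mem_hFamily.2 ⟨hA, ?_⟩)⟩
  have hnt' : IsNontrivialFamily k d (insert A (hFamily k K X)) := by
    refine ⟨?_, hdw, ?_⟩
    · intro B hB
      rcases mem_insert.1 hB with rfl | hB
      · exact hA
      · exact hnt.1 B hB
    · rintro ⟨x, hx⟩
      exact hnt.2.2 ⟨x, fun B hB => hx B (mem_insert_of_mem hB)⟩
  by_cases hKA : K ⊆ A
  · refine Or.inl ⟨hKA, ?_⟩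
    have hex : ∀ y, ∃ F, y ∈ K → F ∈ hFamily k K X ∧ y ∉ F ∧ Disjoint (F \ (K ∪ X)) A := by
      intro y
      by_cases hy : y ∈ K
      · obtain ⟨F, h⟩ := exists_mem_hFamily_erase hKX hy hk (Z := A) (by omega)
        exact ⟨F, fun _ => h⟩
      · exact ⟨∅, fun h => absurd h hy⟩
    choose B hB using hex
    obtain ⟨x, hx⟩ := hdw.exists_mem (S := insert A (K.image B)) (by
        refine insert_subset_insert _ fun F hF => ?_
        obtain ⟨y, hy, rfl⟩ := mem_image.1 hF
        exact (hB y hy).1) (insert_nonempty _ _) (by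
        have h1 := card_insert_le A (K.image B)
        have h2 := card_image_le (s := K) (f := B)
        omega)
    have hxA := hx A (mem_insert_self _ _)
    have hxB : ∀ y ∈ K, x ∈ B y := fun y hy => hx _ (mem_insert_of_mem (mem_image_of_mem B hy))
    have hxK : x ∉ K := fun h => (hB x h).2.1 (hxB x h)
    obtain ⟨y, hy⟩ : K.Nonempty := card_pos.1 (by omega)
    refine ⟨x, mem_inter.2 ⟨hxA, ?_⟩⟩
    by_contra hxX
    refine disjoint_left.1 (hB y hy).2.2 (mem_sdiff.2 ⟨hxB y hy, ?_⟩) hxA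
    simp [hxK, hxX]
  · obtain ⟨y, hy, hyA⟩ := not_subset.1 hKA
    have key : ∀ x ∈ X, ∀ z ∈ insert x K, z ≠ y → z ∈ A := by
      intro x hx z hz hzy
      by_contra hzA
      have hxK : x ∉ K := fun h => disjoint_left.1 hKX h hx
      have hcx : (insert x K).card = d := by rw [card_insert_of_notMem hxK, hK]
      obtain ⟨S, h1, h2, h3⟩ := exists_superset_disjoint (k := k) (insert x K) A
        (by omega) (by omega)
      have hS : S ∈ hFamily k K X := mem_hFamily.2 ⟨h2, Or.inl ⟨(subset_insert _ _).trans h1,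
        x, mem_inter.2 ⟨h1 (mem_insert_self _ _), hx⟩⟩⟩
      have hint := hnt'.card_inter (mem_insert_of_mem hS) (mem_insert_self A _)
      have hsub : S ∩ A ⊆ ((insert x K).erase y).erase z := by
        intro w hw
        rw [mem_inter] at hw
        refine mem_erase.2 ⟨fun h => hzA (h ▸ hw.2), mem_erase.2 ⟨fun h => hyA (h ▸ hw.2), ?_⟩⟩
        by_contra hwx
        exact disjoint_left.1 h3 (mem_sdiff.2 ⟨hw.1, hwx⟩) hw.2
      have h4 := card_le_card hsub
      have h5 := card_erase_add_one (mem_erase.2 ⟨hzy, hz⟩)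
      have h6 := card_erase_add_one (mem_insert_of_mem (b := x) hy)
      omega
    obtain ⟨x0, hx0⟩ : X.Nonempty := card_pos.1 (by omega)
    have hfin := mem_hFamily_of_erase_subset (X := X) hA hy hyA
      (fun z hz => key x0 hx0 z (mem_insert_of_mem (mem_erase.1 hz).2) (mem_erase.1 hz).1)
      (fun x hx => key x hx x (mem_insert_self _ _)
        fun h => disjoint_left.1 hKX hy (h ▸ hx))
    exact (mem_hFamily.1 hfin).2

theorem IsMaximalNontrivialFamily.eq_hFamily_of_subset (hG : IsMaximalNontrivialFamily k d G)
    {K X : Finset (Fin n)} (hK : K.card + 1 = d) (hX : X.Nonempty) (h : G ⊆ hFamily k K X) :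
    G = hFamily k K X := by
  refine h.antisymm fun A hA => hG.mem_of_insert (mem_hFamily.1 hA).1 fun B hB => ?_
  exact isDWiseIntersecting_hFamily hK hX B fun i => insert_subset hA h (hB i)

/-! ### Structure of maximal families with many covers -/

/-- Let `X` be the set of all `z` for which `K ∪ {z}` is a cover. If `X` has at least `k - d + 1`
elements, then the members of `G` that omit an element of `K` have at most one element outside
`K ∪ X`. A member `A ⊇ K` missing `X` would make this element the same for all of them, and it
would be a further element of `X`. -/
theorem IsMaximalNontrivialFamily.eq_hFamily_of_petals (hG : IsMaximalNontrivialFamily k d G)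
    (hd : 3 ≤ d) {K X : Finset (Fin n)} (hK : K.card + 1 = d) (hX2 : 2 ≤ X.card)
    (hXk : k + 1 ≤ d + X.card) (hX : ∀ z, z ∈ X ↔ z ∉ K ∧ insert z K ∈ covers d G) :
    G = hFamily k K X ∧ X.card + d ≤ k + 2 := by
  have hXne : X.Nonempty := card_pos.1 (by omega)
  obtain ⟨x0, hx0⟩ := hXne
  have hKX : Disjoint K X := disjoint_left.2 fun z hz hzX => ((hX z).1 hzX).1 hz
  -- a member omitting `y ∈ K` contains the rest of `K` and all of `X`
  have hmiss : ∀ A ∈ G, ∀ y ∈ K, y ∉ A → K.erase y ⊆ A ∧ X ⊆ A := by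
    intro A hA y hy hyA
    refine ⟨fun z hz => ?_, fun x hx => ?_⟩
    · by_contra hzA
      exact (mem_erase.1 hz).1 (eq_of_mem_covers ((hX x0).1 hx0).2 hA
        (mem_insert_of_mem (mem_erase.1 hz).2) (mem_insert_of_mem hy) hzA hyA)
    · by_contra hxA
      have := eq_of_mem_covers ((hX x).1 hx).2 hA (mem_insert_self _ _)
        (mem_insert_of_mem hy) hxA hyA
      exact ((hX x).1 hx).1 (this ▸ hy)
  have hcard : ∀ y ∈ K, (K.erase y ∪ X).card + 2 = d + X.card := by
    intro y hy
    rw [card_union_of_disjoint (disjoint_of_subset_left (erase_subset _ _) hKX)]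
    have := card_erase_add_one hy
    omega
  choose B hB hyB using hG.1.exists_notMem
  have hBsub : ∀ y ∈ K, K.erase y ∪ X ⊆ B y := fun y hy =>
    union_subset (hmiss _ (hB y) y hy (hyB y)).1 (hmiss _ (hB y) y hy (hyB y)).2
  have hXle : X.card + d ≤ k + 2 := by
    obtain ⟨y, hy⟩ : K.Nonempty := card_pos.1 (by omega)
    have h1 := card_le_card (hBsub y hy)
    have h2 := hcard y hy
    rw [hG.1.1 _ (hB y)] at h1
    omega
  refine ⟨hG.eq_hFamily_of_subset hK ⟨x0, hx0⟩ fun A hA => ?_, hXle⟩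
  by_cases hKA : K ⊆ A
  · refine mem_hFamily.2 ⟨hG.1.1 A hA, Or.inl ⟨hKA, ?_⟩⟩
    by_contra hAX
    have hAX' : ∀ x ∈ A, x ∉ X := fun x hxA hxX => hAX ⟨x, mem_inter.2 ⟨hxA, hxX⟩⟩
    -- any choice of members omitting the elements of `K` has a common element in `A \ (K ∪ X)`
    have hcommon : ∀ f : Fin n → Finset (Fin n), (∀ y ∈ K, f y ∈ G ∧ y ∉ f y) →
        ∃ w, w ∉ K ∧ w ∉ X ∧ ∀ y ∈ K, w ∈ f y := by
      intro f hf
      obtain ⟨x, hx⟩ := hG.1.2.1.exists_mem (S := insert A (K.image f)) (by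
          refine insert_subset hA fun F hF => ?_
          obtain ⟨y, hy, rfl⟩ := mem_image.1 hF
          exact (hf y hy).1) (insert_nonempty _ _) (by
          have h1 := card_insert_le A (K.image f)
          have h2 := card_image_le (s := K) (f := f)
          omega)
      have hxf : ∀ y ∈ K, x ∈ f y := fun y hy => hx _ (mem_insert_of_mem (mem_image_of_mem f hy))
      exact ⟨x, fun h => (hf x h).2 (hxf x h), hAX' x (hx A (mem_insert_self _ _)), hxf⟩
    obtain ⟨w, hwK, hwX, hw⟩ := hcommon B fun y _ => ⟨hB y, hyB y⟩
    have huniq : ∀ y ∈ K, ∀ v ∈ B y, v ∉ K → v ∉ X → v = w := by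
      intro y hy v hv hvK hvX
      have h1 : (B y \ (K.erase y ∪ X)).card ≤ 1 := by
        rw [card_sdiff_of_subset (hBsub y hy), hG.1.1 _ (hB y)]
        have := hcard y hy
        omega
      refine card_le_one.1 h1 v (mem_sdiff.2 ⟨hv, ?_⟩) w (mem_sdiff.2 ⟨hw y hy, ?_⟩)
      · simp [hvK, hvX]
      · simp [hwK, hwX]
    have hwG : ∀ C ∈ G, ∀ y ∈ K, y ∉ C → w ∈ C := by
      intro C hC y hy hyC
      obtain ⟨v, hvK, hvX, hv⟩ := hcommon (Function.update B y C) (by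
        intro z _
        by_cases hzy : z = y
        · subst hzy; simpa using ⟨hC, hyC⟩
        · simpa [Function.update_of_ne hzy] using ⟨hB z, hyB z⟩)
      obtain ⟨z, hz, hzy⟩ := exists_mem_ne (by omega : 1 < K.card) y
      have hvz := hv z hz
      rw [Function.update_of_ne hzy] at hvz
      have hvy := hv y hy
      rw [Function.update_self] at hvy
      rwa [huniq z hz v hvz hvK hvX] at hvy
    refine hwX ((hX w).2 ⟨hwK, mem_covers.2 ⟨by rw [card_insert_of_notMem hwK, hK], ?_⟩⟩)
    intro C hC
    by_cases hKC : K ⊆ C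
    · have := card_le_card (subset_inter (subset_insert w K) hKC)
      omega
    · obtain ⟨y, hy, hyC⟩ := not_subset.1 hKC
      have hsub : insert w (K.erase y) ⊆ insert w K ∩ C := by
        refine subset_inter (insert_subset_insert _ (erase_subset _ _)) ?_
        exact insert_subset (hwG C hC y hy hyC) (hmiss C hC y hy hyC).1
      have h1 := card_le_card hsub
      rw [card_insert_of_notMem fun h => hwK (mem_erase.1 h).2] at h1
      have := card_erase_add_one hy
      omega
  · obtain ⟨y, hy, hyA⟩ := not_subset.1 hKA
    obtain ⟨h1, h2⟩ := hmiss A hA y hy hyA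
    exact mem_hFamily_of_erase_subset (hG.1.1 A hA) hy hyA h1 h2

/-- Three covers inside a `(d + 1)`-set `Y` force every member to omit at most one element
of `Y`. -/
theorem IsMaximalNontrivialFamily.eq_hFamily_of_three_covers
    (hG : IsMaximalNontrivialFamily k d G) (hd : 3 ≤ d) {Y : Finset (Fin n)} (hY : Y.card = d + 1)
    {a b c : Fin n} (ha : a ∈ Y) (hb : b ∈ Y) (hab : a ≠ b) (hac : a ≠ c)
    (hbc : b ≠ c) (hTa : Y.erase a ∈ covers d G) (hTb : Y.erase b ∈ covers d G)
    (hTc : Y.erase c ∈ covers d G) : G = hFamily k (Y \ {a, b}) {a, b} := by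
  have hsub : {a, b} ⊆ Y := by simp [insert_subset_iff, ha, hb]
  have h2 : ({a, b} : Finset (Fin n)).card = 2 := card_pair hab
  have hmiss : ∀ A ∈ G, ∀ u ∈ Y, ∀ v ∈ Y, u ∉ A → v ∉ A → u = v := by
    intro A hA u hu v hv huA hvA
    have key : ∀ z, Y.erase z ∈ covers d G → u ≠ z → v ≠ z → u = v := fun z hz h1 h2 =>
      eq_of_mem_covers hz hA (mem_erase.2 ⟨h1, hu⟩) (mem_erase.2 ⟨h2, hv⟩) huA hvA
    by_contra huv
    by_cases h1 : u = a <;> by_cases h2 : v = a <;> by_cases h3 : u = b <;>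
      by_cases h4 : v = b <;> grind
  refine hG.eq_hFamily_of_subset (by rw [card_sdiff_of_subset hsub, h2]; omega)
    ⟨a, by simp⟩ fun A hA => ?_
  by_cases hKA : Y \ {a, b} ⊆ A
  · refine mem_hFamily.2 ⟨hG.1.1 A hA, Or.inl ⟨hKA, ?_⟩⟩
    by_cases haA : a ∈ A
    · exact ⟨a, by simp [haA]⟩
    · have hbA : b ∈ A := by
        by_contra hbA
        exact hab (hmiss A hA a ha b hb haA hbA)
      exact ⟨b, by simp [hbA]⟩
  · obtain ⟨y, hy, hyA⟩ := not_subset.1 hKA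
    have hyY := (mem_sdiff.1 hy).1
    have hin : ∀ z ∈ Y, z ≠ y → z ∈ A := by
      intro z hz hzy
      by_contra hzA
      exact hzy (hmiss A hA z hz y hyY hzA hyA)
    refine mem_hFamily_of_erase_subset (hG.1.1 A hA) hy hyA ?_ ?_
    · intro z hz
      exact hin z (mem_sdiff.1 (mem_erase.1 hz).2).1 (mem_erase.1 hz).1
    · intro z hz
      exact hin z (hsub hz) fun h => (mem_sdiff.1 hy).2 (h ▸ hz)

/-- Covers pairwise share `d - 1` elements, so they either all contain one `(d - 1)`-set or
three of them lie in one `(d + 1)`-set. -/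
theorem IsMaximalNontrivialFamily.isomorphic_or_card_covers_le
    (hG : IsMaximalNontrivialFamily k d G) (hd : 3 ≤ d) (hdk : d < k) (hn : 2 * k + 1 ≤ n) :
    Isomorphic G (H n k d 2) ∨ Isomorphic G (H n k d (k - d + 1)) ∨
      Isomorphic G (H n k d (k - d + 2)) ∨ (covers d G).card ≤ k - d := by
  by_cases hb : (covers d G).card ≤ k - d
  · tauto
  obtain ⟨T₁, hT₁, T₂, hT₂, hne⟩ := one_lt_card.1 (by omega : 1 < (covers d G).card)
  have hc₁ := (mem_covers.1 hT₁).1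
  have hc₂ := (mem_covers.1 hT₂).1
  have hint := fun {T T'} (h : T ∈ covers d G) (h' : T' ∈ covers d G) =>
    hG.card_inter_covers hdk.le (by omega) h h'
  set K := T₁ ∩ T₂ with hKdef
  have hKc : K.card + 1 = d := by
    have h1 : d ≤ K.card + 1 := hint hT₁ hT₂
    have h2 : K.card < T₁.card := by
      refine card_lt_card ⟨inter_subset_left, fun h => hne ?_⟩
      exact eq_of_subset_of_card_le (h.trans inter_subset_right) (by omega)
    omega
  have hins : ∀ {T : Finset (Fin n)}, T.card = d → K ⊆ T → ∃ x, x ∉ K ∧ insert x K = T := by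
    intro T hT hKT
    obtain ⟨x, hx⟩ := card_eq_one.1 (by rw [card_sdiff_of_subset hKT]; omega : (T \ K).card = 1)
    have hx' : x ∈ T \ K := by rw [hx]; exact mem_singleton_self x
    rw [mem_sdiff] at hx'
    exact ⟨x, hx'.2, eq_of_subset_of_card_le (insert_subset hx'.1 hKT)
      (by rw [card_insert_of_notMem hx'.2]; omega)⟩
  obtain ⟨x₁, hx₁, hx₁T⟩ := hins hc₁ inter_subset_left
  obtain ⟨x₂, hx₂, hx₂T⟩ := hins hc₂ inter_subset_right
  have hx₁₂ : x₁ ≠ x₂ := by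
    rintro rfl
    exact hne (hx₁T ▸ hx₂T)
  by_cases hall : ∀ T ∈ covers d G, K ⊆ T
  · set X := univ.filter fun z => z ∉ K ∧ insert z K ∈ covers d G with hXdef
    have hXmem : ∀ z, z ∈ X ↔ z ∉ K ∧ insert z K ∈ covers d G := by simp [hXdef]
    have hXcard : X.card = (covers d G).card := by
      refine card_bij (fun z _ => insert z K) (fun z hz => ((hXmem z).1 hz).2) ?_ ?_
      · intro z hz w hw hzw
        have : z ∈ insert w K := hzw ▸ mem_insert_self z K
        exact (mem_insert.1 this).resolve_right ((hXmem z).1 hz).1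
      · intro T hT
        obtain ⟨x, hx, hxT⟩ := hins (mem_covers.1 hT).1 (hall T hT)
        exact ⟨x, (hXmem x).2 ⟨hx, hxT ▸ hT⟩, hxT⟩
    obtain ⟨h1, h2⟩ := hG.eq_hFamily_of_petals hd hKc (by omega) (by omega) hXmem
    have hdis : Disjoint K X := disjoint_left.2 fun z hz hzX => ((hXmem z).1 hzX).1 hz
    have hiso := isomorphic_H (k := k) hd (l := X.card) (by omega) (by omega) hdis hKc rfl
    rw [← h1] at hiso
    have : X.card = k - d + 1 ∨ X.card = k - d + 2 := by omega
    rcases this with h | h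
    · rw [h] at hiso; tauto
    · rw [h] at hiso; tauto
  · push Not at hall
    obtain ⟨T₃, hT₃, hKT⟩ := hall
    obtain ⟨y, hy, hyT⟩ := not_subset.1 hKT
    have hyx₁ : y ≠ x₁ := fun h => hx₁ (h ▸ hy)
    have hyx₂ : y ≠ x₂ := fun h => hx₂ (h ▸ hy)
    have hx₂' : x₂ ∉ insert x₁ K := by
      rw [mem_insert]
      rintro (h | h)
      · exact hx₁₂ h.symm
      · exact hx₂ h
    set Y := insert x₂ (insert x₁ K) with hYdef
    have hYc : Y.card = d + 1 := by
      rw [hYdef, card_insert_of_notMem hx₂', card_insert_of_notMem hx₁, hKc]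
    have hyY : y ∈ Y := by simp [hYdef, hy]
    have hY₂ : Y.erase x₂ = T₁ := by rw [hYdef, erase_insert hx₂', hx₁T]
    have hY₁ : Y.erase x₁ = T₂ := by
      rw [hYdef, insert_comm, erase_insert, hx₂T]
      rw [mem_insert]
      rintro (h | h)
      · exact hx₁₂ h
      · exact hx₁ h
    have hsub : ∀ T ∈ covers d G, K ⊆ T → T.erase y ⊆ T₃ := by
      intro T hT hKT z hz
      by_contra hzT
      have h1 := card_sdiff_add_card_inter T T₃
      have h2 := hint hT hT₃
      have h3 := (mem_covers.1 hT).1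
      exact (mem_erase.1 hz).1 (card_le_one.1 (by omega : (T \ T₃).card ≤ 1) z
        (mem_sdiff.2 ⟨(mem_erase.1 hz).2, hzT⟩) y (mem_sdiff.2 ⟨hKT hy, hyT⟩))
    have hY₃ : Y.erase y = T₃ := by
      refine eq_of_subset_of_card_le ?_ ?_
      · intro z hz
        obtain ⟨hzy, hz⟩ := mem_erase.1 hz
        by_cases hzx : z = x₂
        · subst hzx
          exact hsub T₂ hT₂ inter_subset_right
            (mem_erase.2 ⟨hzy, hx₂T ▸ mem_insert_self _ _⟩)
        · refine hsub T₁ hT₁ inter_subset_left (mem_erase.2 ⟨hzy, ?_⟩)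
          rw [← hY₂]
          exact mem_erase.2 ⟨hzx, hz⟩
      · have := card_erase_add_one hyY
        have := (mem_covers.1 hT₃).1
        omega
    have hx₁Y : x₁ ∈ Y := by simp [hYdef]
    have hx₂Y : x₂ ∈ Y := by simp [hYdef]
    have h1 := hG.eq_hFamily_of_three_covers hd hYc hx₁Y hx₂Y hx₁₂ hyx₁.symm hyx₂.symm
      (hY₁ ▸ hT₂) (hY₂ ▸ hT₁) (hY₃ ▸ hT₃)
    have hsubY : ({x₁, x₂} : Finset (Fin n)) ⊆ Y := by simp [insert_subset_iff, hx₁Y, hx₂Y]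
    have h2 : ({x₁, x₂} : Finset (Fin n)).card = 2 := card_pair hx₁₂
    left
    rw [h1]
    refine isomorphic_H hd (by omega) (by omega) sdiff_disjoint ?_ h2
    rw [card_sdiff_of_subset hsubY]
    omega

/-! ### The size of the families with kernel and petals -/

theorem card_hFamily {K X : Finset (Fin n)} (hKX : Disjoint K X)
    (hk : K.card ≤ k) (hkX : K.card + X.card ≤ k + 1) :
    (hFamily k K X).card + (n - (K.card + X.card)).choose (k - K.card) =
      (n - K.card).choose (k - K.card) +
        K.card * (n - (K.card + X.card)).choose (k + 1 - (K.card + X.card)) := by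
  have hYc : (K ∪ X).card = K.card + X.card := card_union_of_disjoint hKX
  set P := univ.powersetCard k (α := Fin n) with hP
  -- the members containing `K`, together with the `k`-sets meeting `K ∪ X` in `K` only
  have h1 : (P.filter fun F => K ⊆ F ∧ (F ∩ X).Nonempty).card +
      (n - (K.card + X.card)).choose (k - K.card) = (n - K.card).choose (k - K.card) := by
    rw [← card_filter_superset hk, ← hYc, ← card_filter_inter_eq subset_union_left hk, ← hP,
      ← card_union_of_disjoint]
    · congr 1
      ext F
      simp only [mem_union, mem_filter, ← and_or_left, and_congr_right_iff]
      intro _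
      constructor
      · rintro (h | h)
        · exact h.1
        · rw [← h]; exact inter_subset_left
      · intro h
        by_cases hF : (F ∩ X).Nonempty
        · exact Or.inl ⟨h, hF⟩
        · rw [not_nonempty_iff_eq_empty] at hF
          right
          rw [inter_union_distrib_left, hF, union_empty, inter_eq_right.2 h]
    · rw [disjoint_left]
      intro F h1 h2
      obtain ⟨x, hx⟩ := (mem_filter.1 h1).2.2
      rw [mem_inter] at hx
      have : x ∈ K := by
        rw [← (mem_filter.1 h2).2]
        exact mem_inter.2 ⟨hx.1, mem_union_right _ hx.2⟩
      exact disjoint_left.1 hKX this hx.2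
  have herase : ∀ y ∈ K, ∀ F : Finset (Fin n), F ∩ (K ∪ X) = K.erase y ∪ X →
      K ∩ F = K.erase y ∧ X ⊆ F := by
    intro y hy F hF
    have hmem : ∀ z, z ∈ F ∧ (z ∈ K ∨ z ∈ X) ↔ (z ≠ y ∧ z ∈ K) ∨ z ∈ X := by
      intro z
      have : z ∈ F ∩ (K ∪ X) ↔ z ∈ K.erase y ∪ X := by rw [hF]
      simpa using this
    refine ⟨?_, fun z hz => ((hmem z).2 (Or.inr hz)).1⟩
    ext z
    have := hmem z
    have hd : z ∈ K → z ∉ X := fun h => disjoint_left.1 hKX h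
    rw [mem_inter, mem_erase]
    tauto
  have h2 : (P.filter fun F => (K ∩ F).card + 1 = K.card ∧ X ⊆ F).card =
      K.card * (n - (K.card + X.card)).choose (k + 1 - (K.card + X.card)) := by
    have : (P.filter fun F => (K ∩ F).card + 1 = K.card ∧ X ⊆ F) =
        K.biUnion fun y => P.filter fun F => F ∩ (K ∪ X) = K.erase y ∪ X := by
      ext F
      simp only [mem_filter, mem_biUnion]
      constructor
      · rintro ⟨hF, hc, hXF⟩
        have hc' := card_sdiff_add_card_inter K F
        obtain ⟨y, hy⟩ := card_eq_one.1 (by omega : (K \ F).card = 1)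
        have hmem : ∀ z, z ∈ K ∧ z ∉ F ↔ z = y := by
          intro z
          rw [← mem_sdiff, hy, mem_singleton]
        refine ⟨y, ((hmem y).2 rfl).1, hF, ?_⟩
        ext z
        have := hmem z
        have hz : z ∈ X → z ∈ F := fun h => hXF h
        have hd : z ∈ K → z ∉ X := fun h => disjoint_left.1 hKX h
        simp only [mem_inter, mem_union, mem_erase]
        tauto
      · rintro ⟨y, hy, hF, he⟩
        obtain ⟨h3, h4⟩ := herase y hy F he
        exact ⟨hF, by rw [h3, card_erase_add_one hy], h4⟩
    rw [this, card_biUnion]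
    · rw [sum_const_nat]
      intro y hy
      have hc : (K.erase y ∪ X).card = K.card + X.card - 1 := by
        rw [card_union_of_disjoint (disjoint_of_subset_left (erase_subset _ _) hKX)]
        have := card_erase_add_one hy
        omega
      have hpos := card_pos.2 ⟨y, hy⟩
      rw [hP, card_filter_inter_eq (union_subset_union_left (erase_subset _ _)) (by omega), hYc, hc]
      congr 1
      omega
    · intro y hy z hz hyz
      refine disjoint_left.2 fun F h3 h4 => ?_
      have h5 := (herase y hy F (mem_filter.1 h3).2).1
      have h6 := (herase z hz F (mem_filter.1 h4).2).1
      have : z ∈ K.erase z := by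
        rw [← h6, h5]
        exact mem_erase.2 ⟨hyz.symm, hz⟩
      exact (mem_erase.1 this).1 rfl
  have h3 : hFamily k K X = (P.filter fun F => K ⊆ F ∧ (F ∩ X).Nonempty) ∪
      (P.filter fun F => (K ∩ F).card + 1 = K.card ∧ X ⊆ F) := by
    rw [← filter_or, hFamily]
  rw [h3, card_union_of_disjoint, ← h2, ← h1]
  · omega
  · refine disjoint_filter.2 fun F _ h4 h5 => ?_
    rw [inter_eq_left.2 h4.1] at h5
    omega

/-- The size of `H n k d l`, with `r = k - d` and `N = n - d + 1`. -/
theorem card_H {N r l : ℕ} (hd : 3 ≤ d) (hl : 1 ≤ l) (hlr : l ≤ r + 2) (hN : r + 2 ≤ N)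
    (hn : n + 1 = N + d) :
    (H n (d + r) d l).card + (N - l).choose (r + 1) =
      N.choose (r + 1) + (d - 1) * (N - l).choose (r + 2 - l) := by
  have hK : (interval n 1 (d - 1)).card = d - 1 := by
    rw [card_interval le_rfl (by omega)]; omega
  have hX : (interval n d (d + l - 1)).card = l := by
    rw [card_interval (by omega) (by omega)]; omega
  have h := card_hFamily (k := d + r)
    (disjoint_interval (n := n) 1 (d - 1) d (d + l - 1) (by omega))
    (by omega) (by omega)
  rw [hK, hX] at h
  rw [H_eq_hFamily hd (by omega)]
  have e1 : n - (d - 1 + l) = N - l := by omega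
  have e2 : d + r - (d - 1) = r + 1 := by omega
  have e3 : n - (d - 1) = N := by omega
  have e4 : d + r + 1 - (d - 1 + l) = r + 2 - l := by omega
  rwa [e1, e2, e3, e4] at h

/-! ### Binomial estimates -/

theorem choose_add_succ_le (M m l : ℕ) :
    (M + l).choose (m + 1) ≤ M.choose (m + 1) + l * (M + l - 1).choose m := by
  induction l with
  | zero => simp
  | succ l ih =>
    have h1 : (M + (l + 1)).choose (m + 1) = (M + l).choose m + (M + l).choose (m + 1) :=
      Nat.choose_succ_succ _ _
    have h2 : (M + l - 1).choose m ≤ (M + l).choose m := Nat.choose_le_choose _ (by omega)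
    have h3 : M + (l + 1) - 1 = M + l := by omega
    rw [h1, h3, add_one_mul]
    have := Nat.mul_le_mul_left l h2
    omega

theorem le_choose_add_succ (M m l : ℕ) :
    M.choose (m + 1) + l * M.choose m ≤ (M + l).choose (m + 1) := by
  induction l with
  | zero => simp
  | succ l ih =>
    have h1 : (M + (l + 1)).choose (m + 1) = (M + l).choose m + (M + l).choose (m + 1) :=
      Nat.choose_succ_succ _ _
    have h2 : M.choose m ≤ (M + l).choose m := Nat.choose_le_choose _ (by omega)
    rw [h1, add_one_mul]
    omega

theorem choose_le_choose_add (a b s : ℕ) : a.choose b ≤ (a + s).choose (b + s) := by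
  induction s with
  | zero => simp
  | succ s ih =>
    have : (a + (s + 1)).choose (b + (s + 1)) = (a + s).choose (b + s) +
      (a + s).choose (b + s + 1) := Nat.choose_succ_succ _ _
    omega

theorem choose_lt_choose_add {a b s : ℕ} (hs : 0 < s) (hab : b < a) :
    a.choose b < (a + s).choose (b + s) := by
  obtain ⟨s, rfl⟩ := Nat.exists_eq_add_of_lt hs
  have h1 : (a + (0 + s + 1)).choose (b + (0 + s + 1)) = (a + s).choose (b + s) +
      (a + s).choose (b + s + 1) := by
    rw [zero_add]
    exact Nat.choose_succ_succ _ _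
  have h2 := choose_le_choose_add a b s
  have h3 : 0 < (a + s).choose (b + s + 1) := Nat.choose_pos (by omega)
  omega

theorem mul_choose_le_card_H {N r l : ℕ} (hd : 3 ≤ d) (hl : 1 ≤ l) (hlr : l ≤ r + 2)
    (hN : r + 2 ≤ N) (hn : n + 1 = N + d) :
    l * (N - l).choose r ≤ (H n (d + r) d l).card := by
  have h1 := card_H hd hl hlr hN hn
  have h2 := le_choose_add_succ (N - l) r l
  rw [Nat.sub_add_cancel (by omega)] at h2
  omega

theorem mul_choose_le_card_H_two {N r : ℕ} (hd : 3 ≤ d) (hN : r + 2 ≤ N) (hn : n + 1 = N + d) :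
    (d + 1) * (N - 2).choose r ≤ (H n (d + r) d 2).card := by
  have h1 := card_H hd (l := 2) (by omega) (by omega) hN hn
  have h2 := le_choose_add_succ (N - 2) r 2
  rw [Nat.sub_add_cancel (by omega)] at h2
  have h3 : d + 1 = 2 + (d - 1) := by omega
  rw [Nat.add_sub_cancel] at h1
  rw [h3, add_mul]
  omega

theorem card_H_two_le {N r : ℕ} (hd : 3 ≤ d) (hN : r + 2 ≤ N) (hn : n + 1 = N + d) :
    (H n (d + r) d 2).card ≤ (d + 1) * (N - 1).choose r := by
  have h1 := card_H hd (l := 2) (by omega) (by omega) hN hn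
  have h2 := choose_add_succ_le (N - 2) r 2
  rw [Nat.sub_add_cancel (by omega)] at h2
  have h3 : d + 1 = 2 + (d - 1) := by omega
  rw [Nat.add_sub_cancel] at h1
  have h4 : (N - 2).choose r ≤ (N - 1).choose r := Nat.choose_le_choose _ (by omega)
  have := Nat.mul_le_mul_left (d - 1) h4
  rw [h3, add_mul]
  omega

theorem card_H_le {N r l : ℕ} (hd : 3 ≤ d) (hl : 3 ≤ l) (hlr : l ≤ r + 2)
    (hN : r + 2 ≤ N) (hn : n + 1 = N + d) :
    (H n (d + r) d l).card ≤ l * (N - 1).choose r + (d - 1) * (N - 2).choose (r - 1) := by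
  have h1 := card_H hd (by omega) hlr hN hn
  have h2 := choose_add_succ_le (N - l) r l
  rw [Nat.sub_add_cancel (by omega)] at h2
  have h3 : (N - l).choose (r + 2 - l) ≤ (N - 2).choose (r - 1) := by
    refine (choose_le_choose_add _ _ (l - 3)).trans ?_
    rw [show r + 2 - l + (l - 3) = r - 1 by omega]
    exact Nat.choose_le_choose _ (by omega)
  have := Nat.mul_le_mul_left (d - 1) h3
  omega

/-- The sizes of these two families have the same leading term when `l = d + 1`; the comparison
rests on the terms of second order. -/
theorem card_H_lt_card_H_two {N r l : ℕ} (hd : 3 ≤ d) (hl : 3 ≤ l) (hlr : l ≤ r + 2)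
    (hld : l ≤ d + 1) (hN : r + 3 ≤ N) (hn : n + 1 = N + d) :
    (H n (d + r) d l).card < (H n (d + r) d 2).card := by
  have h1 := card_H hd (by omega) hlr (by omega) hn
  have h2 := card_H hd (l := 2) (r := r) (by omega) (by omega) (by omega) hn
  rw [Nat.add_sub_cancel] at h2
  have h3 := choose_add_succ_le (N - l) r (l - 2)
  rw [show N - l + (l - 2) = N - 2 by omega, show N - 2 - 1 = N - 3 by omega] at h3
  have hs : (N - 2).choose r = (N - 3).choose (r - 1) + (N - 3).choose r := by
    rw [show N - 2 = N - 3 + 1 by omega, show r = r - 1 + 1 by omega]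
    exact Nat.choose_succ_succ _ _
  have h4 : (l - 2) * (N - 3).choose r ≤ (d - 1) * (N - 3).choose r :=
    Nat.mul_le_mul_right _ (by omega)
  suffices h5 : (l - 2) * (N - 3).choose r + (d - 1) * (N - l).choose (r + 2 - l) <
      (d - 1) * (N - 3).choose (r - 1) + (d - 1) * (N - 3).choose r by
    rw [hs, mul_add] at h2
    omega
  rcases hl.eq_or_lt with rfl | hl'
  · have h6 : 0 < (N - 3).choose r := Nat.choose_pos (by omega)
    have h7 : (3 - 2) * (N - 3).choose r < (d - 1) * (N - 3).choose r :=
      Nat.mul_lt_mul_of_pos_right (by omega) h6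
    rw [show r + 2 - 3 = r - 1 by omega]
    omega
  · have h6 : (N - l).choose (r + 2 - l) < (N - 3).choose (r - 1) := by
      have := choose_lt_choose_add (a := N - l) (b := r + 2 - l) (s := l - 3)
        (by omega) (by omega)
      rwa [show N - l + (l - 3) = N - 3 by omega,
        show r + 2 - l + (l - 3) = r - 1 by omega] at this
    have h7 := Nat.mul_lt_mul_of_pos_left h6 (by omega : 0 < d - 1)
    omega

/-- For large ground sets the leading coefficient decides: families of size about
`c * (N - 1).choose r` are smaller than families of size at least `c' * (N - r - 2).choose r`. -/
theorem mul_choose_add_lt {N r c c' : ℕ} (hr : 2 ≤ r) (hd : 3 ≤ d) (hcc : c < c')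
    (hc : c + 1 ≤ d + r) (hN : 2 * r * (d + r) ^ (d + 1) < N - 1) (hN2 : r + 2 ≤ N) :
    c * (N - 1).choose r + (d + r) ^ (d + 1) * (N - 2).choose (r - 1) <
      c' * (N - r - 2).choose r := by
  obtain ⟨s, rfl⟩ : ∃ s, r = s + 1 := ⟨r - 1, by omega⟩
  set k := d + (s + 1) with hk
  rw [Nat.add_sub_cancel]
  set P := (N - 2).choose s with hP
  set Q := (N - 1).choose (s + 1) with hQ
  set R := (N - (s + 1) - 2).choose (s + 1) with hR
  have hQR : Q ≤ R + (s + 2) * P := by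
    have := choose_add_succ_le (N - (s + 1) - 2) s (s + 2)
    rwa [show N - (s + 1) - 2 + (s + 2) = N - 1 by omega, show N - 1 - 1 = N - 2 by omega] at this
  have hPpos : 0 < P := Nat.choose_pos (by omega)
  have hPQ : (N - 1) * P = Q * (s + 1) := by
    have := Nat.add_one_mul_choose_eq (N - 2) s
    rwa [show N - 2 + 1 = N - 1 by omega] at this
  have hpow : k * (s + 2) ≤ k ^ (d + 1) := by
    calc k * (s + 2) ≤ k * k := Nat.mul_le_mul_left _ (by omega)
      _ = k ^ 2 := (sq k).symm
      _ ≤ k ^ (d + 1) := Nat.pow_le_pow_right (by omega) (by omega)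
  have hmain : ((c + 1) * (s + 2) + k ^ (d + 1)) * P < Q := by
    have h1 : (s + 1) * ((c + 1) * (s + 2) + k ^ (d + 1)) < N - 1 := by
      refine lt_of_le_of_lt ?_ hN
      have : (c + 1) * (s + 2) ≤ k * (s + 2) := Nat.mul_le_mul_right _ hc
      calc (s + 1) * ((c + 1) * (s + 2) + k ^ (d + 1)) ≤
          (s + 1) * (k ^ (d + 1) + k ^ (d + 1)) := Nat.mul_le_mul_left _ (by omega)
        _ = 2 * (s + 1) * k ^ (d + 1) := by ring
    have h2 := Nat.mul_lt_mul_of_pos_right h1 hPpos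
    rw [hPQ, mul_assoc, mul_comm Q] at h2
    exact lt_of_mul_lt_mul_left h2 (Nat.zero_le _)
  have h3 : (c + 1) * R ≤ c' * R := Nat.mul_le_mul_right _ hcc
  have h4 : (c + 1) * Q ≤ (c + 1) * (R + (s + 2) * P) := Nat.mul_le_mul_left _ hQR
  refine lt_of_lt_of_le ?_ h3
  rw [add_mul] at hmain
  nlinarith

/-! ### Families with few covers are small -/

/-- Branching: a set `T` that is not a cover has at most `d - 2` elements in some member, so each
member containing `T` also contains one of at most `k` further elements. -/
theorem IsNontrivialFamily.card_filter_superset_le (hG : IsNontrivialFamily k d G) (hd : 3 ≤ d)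
    (hdk : d < k) (j : ℕ) (T : Finset (Fin n)) (hT : T.card + j = d + 1) :
    (G.filter fun A => T ⊆ A ∧ ∀ C ∈ covers d G, ¬ C ⊆ A).card ≤
      k ^ j * (n - d - 1).choose (k - d - 1) := by
  induction j generalizing T with
  | zero =>
    rw [pow_zero, one_mul]
    have h1 := card_filter_superset (k := k) (T := T) (by omega)
    rw [show n - T.card = n - d - 1 by omega, show k - T.card = k - d - 1 by omega] at h1
    rw [← h1]
    refine card_le_card fun A hA => ?_
    rw [mem_filter] at hA ⊢
    exact ⟨mem_powersetCard.2 ⟨subset_univ _, hG.1 A hA.1⟩, hA.2.1⟩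
  | succ j ih =>
    by_cases hTc : T ∈ covers d G
    · rw [filter_false_of_mem]
      · simp
      · intro A _ h
        exact h.2 T hTc h.1
    rcases G.eq_empty_or_nonempty with rfl | hGne
    · simp
    obtain ⟨B, hB, hTB⟩ : ∃ B ∈ G, (T ∩ B).card + 1 < d := by
      rcases (by omega : T.card = d ∨ T.card + 1 = d ∨ T.card + 1 < d) with h | h | h
      · rw [mem_covers] at hTc
        push Not at hTc
        exact hTc h
      · obtain ⟨x, hx⟩ : T.Nonempty := card_pos.1 (by omega)
        obtain ⟨B, hB, hxB⟩ := hG.exists_notMem x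
        refine ⟨B, hB, ?_⟩
        have : T ∩ B ⊂ T := ⟨inter_subset_left, fun h => hxB (mem_inter.1 (h hx)).2⟩
        have := card_lt_card this
        omega
      · obtain ⟨B, hB⟩ := hGne
        exact ⟨B, hB, by have := card_le_card (inter_subset_left (s₁ := T) (s₂ := B)); omega⟩
    have hsub : (G.filter fun A => T ⊆ A ∧ ∀ C ∈ covers d G, ¬ C ⊆ A) ⊆
        (B \ T).biUnion fun x => G.filter fun A => insert x T ⊆ A ∧ ∀ C ∈ covers d G, ¬ C ⊆ A := by
      intro A hA
      rw [mem_filter] at hA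
      have h1 := hG.card_inter hA.1 hB
      obtain ⟨x, hx, hxT⟩ : ∃ x ∈ A ∩ B, x ∉ T ∩ B :=
        not_subset.1 fun h => by have := card_le_card h; omega
      rw [mem_inter] at hx hxT
      rw [mem_biUnion]
      exact ⟨x, mem_sdiff.2 ⟨hx.2, fun h => hxT ⟨h, hx.2⟩⟩,
        mem_filter.2 ⟨hA.1, insert_subset hx.1 hA.2.1, hA.2.2⟩⟩
    refine (card_le_card hsub).trans (card_biUnion_le.trans ?_)
    calc ∑ x ∈ B \ T, (G.filter fun A => insert x T ⊆ A ∧ ∀ C ∈ covers d G, ¬ C ⊆ A).card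
        ≤ ∑ x ∈ B \ T, k ^ j * (n - d - 1).choose (k - d - 1) := by
          refine sum_le_sum fun x hx => ih _ ?_
          rw [card_insert_of_notMem (mem_sdiff.1 hx).2]
          omega
      _ = (B \ T).card * (k ^ j * (n - d - 1).choose (k - d - 1)) := by
          rw [sum_const, smul_eq_mul]
      _ ≤ k * (k ^ j * (n - d - 1).choose (k - d - 1)) := by
          refine Nat.mul_le_mul_right _ ?_
          rw [← hG.1 B hB]
          exact card_le_card sdiff_subset
      _ = k ^ (j + 1) * (n - d - 1).choose (k - d - 1) := by ring

theorem IsNontrivialFamily.card_filter_cover_le (hG : IsNontrivialFamily k d G) (hdk : d ≤ k)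
    {C : Finset (Fin n)} (hC : C.card = d) :
    (G.filter fun A => C ⊆ A).card ≤ (n - d).choose (k - d) := by
  have h1 := card_filter_superset (k := k) (T := C) (by omega)
  rw [hC] at h1
  rw [← h1]
  refine card_le_card fun A hA => ?_
  rw [mem_filter] at hA ⊢
  exact ⟨mem_powersetCard.2 ⟨subset_univ _, hG.1 A hA.1⟩, hA.2⟩

theorem IsNontrivialFamily.card_le_add (hG : IsNontrivialFamily k d G) (hdk : d ≤ k) :
    G.card ≤ (covers d G).card * (n - d).choose (k - d) +
      (G.filter fun A => ∀ C ∈ covers d G, ¬ C ⊆ A).card := by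
  have hsub : G ⊆ ((covers d G).biUnion fun C => G.filter fun A => C ⊆ A) ∪
      (G.filter fun A => ∀ C ∈ covers d G, ¬ C ⊆ A) := by
    intro A hA
    rw [mem_union, mem_biUnion, mem_filter]
    by_cases h : ∃ C ∈ covers d G, C ⊆ A
    · obtain ⟨C, hC, hCA⟩ := h
      exact Or.inl ⟨C, hC, mem_filter.2 ⟨hA, hCA⟩⟩
    · push Not at h
      exact Or.inr ⟨hA, h⟩
  refine (card_le_card hsub).trans ((card_union_le _ _).trans (Nat.add_le_add_right ?_ _))
  exact card_biUnion_le_card_mul _ _ _ fun C hC =>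
    hG.card_filter_cover_le hdk (mem_covers.1 hC).1

theorem IsNontrivialFamily.card_le (hG : IsNontrivialFamily k d G) (hd : 3 ≤ d) (hdk : d < k) :
    G.card ≤ (covers d G).card * (n - d).choose (k - d) +
      k ^ (d + 1) * (n - d - 1).choose (k - d - 1) := by
  refine (hG.card_le_add hdk.le).trans (Nat.add_le_add_left ?_ _)
  have := hG.card_filter_superset_le hd hdk (d + 1) ∅ (by simp)
  simpa using this

/-! ### Families of `(d + 1)`-sets with at most one cover -/

/-- If `B` shares at most `d - 2` elements with `T`, then every member `T ∪ {x}` has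
`x ∈ B \ T`, and it shares `d - 1` elements with `B` only if `B \ T` has three elements. -/
theorem IsNontrivialFamily.card_filter_superset_le_three (hG : IsNontrivialFamily (d + 1) d G)
    {T : Finset (Fin n)} (hT : T.card = d) (hTc : T ∉ covers d G) :
    (G.filter fun A => T ⊆ A).card ≤ 3 := by
  rw [mem_covers] at hTc
  push Not at hTc
  obtain ⟨B, hB, hTB⟩ := hTc hT
  rcases (G.filter fun A => T ⊆ A).eq_empty_or_nonempty with h | ⟨A₀, hA₀⟩
  · rw [h]; simp
  have key : ∀ A ∈ G.filter fun A => T ⊆ A, ∃ x ∈ B \ T, insert x T = A := by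
    intro A hA
    rw [mem_filter] at hA
    have h1 := hG.card_inter hA.1 hB
    obtain ⟨x, hx, hxT⟩ : ∃ x ∈ A ∩ B, x ∉ T ∩ B :=
      not_subset.1 fun h => by have := card_le_card h; omega
    rw [mem_inter] at hx hxT
    have hxT' : x ∉ T := fun h => hxT ⟨h, hx.2⟩
    refine ⟨x, mem_sdiff.2 ⟨hx.2, hxT'⟩, eq_of_subset_of_card_le (insert_subset hx.1 hA.2) ?_⟩
    rw [card_insert_of_notMem hxT', hT, hG.1 A hA.1]
  have hBT : (B \ T).card ≤ 3 := by
    obtain ⟨x, hx, hxA⟩ := key A₀ hA₀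
    have h1 := hG.card_inter (mem_filter.1 hA₀).1 hB
    rw [← hxA] at h1
    have h2 : (insert x T ∩ B).card ≤ (T ∩ B).card + 1 :=
      (card_le_card (by
        intro z hz
        simp only [mem_inter, mem_insert] at hz ⊢
        tauto : insert x T ∩ B ⊆ insert x (T ∩ B))).trans (card_insert_le _ _)
    have h3 := card_sdiff_add_card_inter B T
    rw [inter_comm, hG.1 B hB] at h3
    omega
  calc (G.filter fun A => T ⊆ A).card ≤ ((B \ T).image fun x => insert x T).card := by
        refine card_le_card fun A hA => ?_
        obtain ⟨x, hx, hxA⟩ := key A hA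
        exact mem_image.2 ⟨x, hx, hxA⟩
    _ ≤ (B \ T).card := card_image_le
    _ ≤ 3 := hBT

/-- A member omitting `y ∈ T` shares one of two elements outside `T` with a fixed member omitting
another element of `T`. -/
theorem IsNontrivialFamily.card_le_of_covers_eq_singleton (hG : IsNontrivialFamily (d + 1) d G)
    (hd : 3 ≤ d) {T : Finset (Fin n)} (hT : covers d G = {T}) : G.card ≤ n - d + 6 * d := by
  have hTc : T ∈ covers d G := by rw [hT]; exact mem_singleton_self T
  have hTd := (mem_covers.1 hTc).1
  have h := hG.card_le_add (by omega)
  rw [hT, card_singleton, one_mul, Nat.add_sub_cancel_left, Nat.choose_one_right] at h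
  refine h.trans (Nat.add_le_add_left ?_ _)
  have hex : ∀ y ∈ T, ∃ U : Finset (Fin n), U.card ≤ 2 ∧ Disjoint U T ∧
      ∀ A ∈ G, y ∉ A → ∃ u ∈ U, insert u (T.erase y) ⊆ A := by
    intro y hy
    obtain ⟨z, hz, hzy⟩ := exists_mem_ne (by omega : 1 < T.card) y
    obtain ⟨E, hE, hzE⟩ := hG.exists_notMem z
    refine ⟨E \ T, ?_, sdiff_disjoint, fun A hA hyA => ?_⟩
    · have h1 := card_sdiff_add_card_inter E T
      have h2 := (mem_covers.1 hTc).2 E hE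
      rw [hG.1 E hE, inter_comm] at h1
      omega
    · have hTA : T.erase y ⊆ A := by
        intro w hw
        by_contra hwA
        exact (mem_erase.1 hw).1 (eq_of_mem_covers hTc hA (mem_erase.1 hw).2 hy hwA hyA)
      have h1 := hG.card_inter hA hE
      have h2 := card_erase_add_one (mem_erase.2 ⟨hzy, hz⟩)
      have h3 := card_erase_add_one hy
      obtain ⟨u, hu, huT⟩ : ∃ u ∈ A ∩ E, u ∉ (T.erase y).erase z :=
        not_subset.1 fun h => by have := card_le_card h; omega
      rw [mem_inter] at hu
      have huz : u ≠ z := fun h => hzE (h ▸ hu.2)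
      have huy : u ≠ y := fun h => hyA (h ▸ hu.1)
      refine ⟨u, mem_sdiff.2 ⟨hu.2, fun h => huT ?_⟩, insert_subset hu.1 hTA⟩
      exact mem_erase.2 ⟨huz, mem_erase.2 ⟨huy, h⟩⟩
  have hR : ∀ y ∈ T, (G.filter fun A => y ∉ A).card ≤ 6 := by
    intro y hy
    obtain ⟨U, hU, hUT, hUA⟩ := hex y hy
    have hsub : (G.filter fun A => y ∉ A) ⊆
        U.biUnion fun u => G.filter fun A => insert u (T.erase y) ⊆ A := by
      intro A hA
      rw [mem_filter] at hA
      obtain ⟨u, hu, huA⟩ := hUA A hA.1 hA.2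
      exact mem_biUnion.2 ⟨u, hu, mem_filter.2 ⟨hA.1, huA⟩⟩
    refine (card_le_card hsub).trans ((card_biUnion_le_card_mul _ _ 3 fun u hu => ?_).trans
      (Nat.mul_le_mul_right 3 hU))
    have huT : u ∉ T := disjoint_left.1 hUT hu
    refine hG.card_filter_superset_le_three ?_ ?_
    · rw [card_insert_of_notMem fun h => huT (mem_erase.1 h).2, card_erase_add_one hy, hTd]
    · rw [hT, mem_singleton]
      intro h
      exact huT (h ▸ mem_insert_self u _)
  have hsub : (G.filter fun A => ∀ C ∈ ({T} : Finset (Finset (Fin n))), ¬ C ⊆ A) ⊆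
      T.biUnion fun y => G.filter fun A => y ∉ A := by
    intro A hA
    rw [mem_filter] at hA
    obtain ⟨y, hy, hyA⟩ := not_subset.1 (hA.2 T (mem_singleton_self T))
    exact mem_biUnion.2 ⟨y, hy, mem_filter.2 ⟨hA.1, hyA⟩⟩
  refine (card_le_card hsub).trans ((card_biUnion_le_card_mul _ _ 6 hR).trans ?_)
  rw [hTd, mul_comm]

/-- Without covers every `d`-set lies in at most three members. If all pairs of members share `d`
elements, each member contains a `d`-subset of a fixed one. Otherwise let `A` and `B` share a set
`S` of size `d - 1`: a member either contains `S`, or it contains a `d`-set consisting of all but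
one element of `S`, one element of `A \ S` and one of `B \ S`. -/
theorem IsNontrivialFamily.card_le_of_covers_eq_empty (hG : IsNontrivialFamily (d + 1) d G)
    (hd : 3 ≤ d) (hc : covers d G = ∅) : G.card + 3 ≤ 12 * d := by
  have hdeg : ∀ T : Finset (Fin n), T.card = d → (G.filter fun A => T ⊆ A).card ≤ 3 :=
    fun T hT => hG.card_filter_superset_le_three hT (by rw [hc]; exact notMem_empty T)
  by_cases hpair : ∀ A ∈ G, ∀ B ∈ G, d ≤ (A ∩ B).card
  · rcases G.eq_empty_or_nonempty with rfl | ⟨A, hA⟩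
    · rw [card_empty]; omega
    have hAc := hG.1 A hA
    have hsub : G ⊆ A.biUnion fun x => G.filter fun B => A.erase x ⊆ B := by
      intro B hB
      have h1 := hpair A hA B hB
      have h2 := card_sdiff_add_card_inter A B
      rcases (A \ B).eq_empty_or_nonempty with h | ⟨x, hx⟩
      · obtain ⟨x, hx⟩ : A.Nonempty := card_pos.1 (by omega)
        exact mem_biUnion.2 ⟨x, hx, mem_filter.2 ⟨hB, (erase_subset _ _).trans
          (sdiff_eq_empty_iff_subset.1 h)⟩⟩
      · refine mem_biUnion.2 ⟨x, (mem_sdiff.1 hx).1, mem_filter.2 ⟨hB, fun z hz => ?_⟩⟩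
        by_contra hzB
        exact (mem_erase.1 hz).1 (card_le_one.1 (by omega : (A \ B).card ≤ 1) z
          (mem_sdiff.2 ⟨(mem_erase.1 hz).2, hzB⟩) x hx)
    have h1 := (card_le_card hsub).trans (card_biUnion_le_card_mul _ _ 3 fun x hx =>
      hdeg _ (by have := card_erase_add_one hx; omega))
    omega
  push Not at hpair
  obtain ⟨A, hA, B, hB, hAB⟩ := hpair
  have hAc := hG.1 A hA
  have hBc := hG.1 B hB
  set S := A ∩ B with hS
  have hSc : S.card + 1 = d := by
    have : d ≤ S.card + 1 := hG.card_inter hA hB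
    omega
  have hSD : ∀ D ∈ G, d ≤ (S ∩ D).card + 2 := fun D hD => hG.card_inter_inter hA hB hD
  have hcontain : (G.filter fun D => S ⊆ D).card ≤ 9 := by
    obtain ⟨y, hy⟩ : S.Nonempty := card_pos.1 (by omega)
    obtain ⟨C, hC, hyC⟩ := hG.exists_notMem y
    have hSC : (S ∩ C).card + 1 ≤ S.card := by
      have : S ∩ C ⊂ S := ⟨inter_subset_left, fun h => hyC (mem_inter.1 (h hy)).2⟩
      exact card_lt_card this
    have hCS : (C \ S).card ≤ 3 := by
      have h1 := card_sdiff_add_card_inter C S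
      have h2 := hSD C hC
      rw [inter_comm, hG.1 C hC] at h1
      omega
    have hsub : (G.filter fun D => S ⊆ D) ⊆
        (C \ S).biUnion fun x => G.filter fun D => insert x S ⊆ D := by
      intro D hD
      rw [mem_filter] at hD
      have h1 := hG.card_inter hD.1 hC
      obtain ⟨x, hx, hxS⟩ : ∃ x ∈ D ∩ C, x ∉ S ∩ C :=
        not_subset.1 fun h => by have := card_le_card h; omega
      rw [mem_inter] at hx hxS
      exact mem_biUnion.2 ⟨x, mem_sdiff.2 ⟨hx.2, fun h => hxS ⟨h, hx.2⟩⟩,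
        mem_filter.2 ⟨hD.1, insert_subset hx.1 hD.2⟩⟩
    have h1 := (card_le_card hsub).trans (card_biUnion_le_card_mul _ _ 3 fun x hx =>
      hdeg _ (by rw [card_insert_of_notMem (mem_sdiff.1 hx).2, hSc]))
    omega
  have hAS : (A \ S).card = 2 := by
    have h : (A \ S).card = A.card - S.card := card_sdiff_of_subset inter_subset_left
    omega
  have hBS : (B \ S).card = 2 := by
    have h : (B \ S).card = B.card - S.card := card_sdiff_of_subset inter_subset_right
    omega
  have hmiss : ∀ s ∈ S, (G.filter fun D => s ∉ D).card ≤ 12 := by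
    intro s hs
    have hse := card_erase_add_one hs
    have hsub : (G.filter fun D => s ∉ D) ⊆ ((A \ S) ×ˢ (B \ S)).biUnion fun p =>
        G.filter fun D => insert p.1 (insert p.2 (S.erase s)) ⊆ D := by
      intro D hD
      obtain ⟨hD, hsD⟩ := mem_filter.1 hD
      have hSsub : S.erase s ⊆ D := by
        intro z hz
        by_contra hzD
        have h1 := card_sdiff_add_card_inter S D
        have h2 := hSD D hD
        exact (mem_erase.1 hz).1 (card_le_one.1 (by omega : (S \ D).card ≤ 1) z
          (mem_sdiff.2 ⟨(mem_erase.1 hz).2, hzD⟩) s (mem_sdiff.2 ⟨hs, hsD⟩))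
      have hout : ∀ E ∈ G, ∃ u ∈ E \ S, u ∈ D := by
        intro E hE
        have h1 := hG.card_inter hD hE
        obtain ⟨u, hu, huS⟩ : ∃ u ∈ D ∩ E, u ∉ S.erase s :=
          not_subset.1 fun h => by have := card_le_card h; omega
        rw [mem_inter] at hu
        refine ⟨u, mem_sdiff.2 ⟨hu.2, fun h => huS (mem_erase.2 ⟨?_, h⟩)⟩, hu.1⟩
        rintro rfl
        exact hsD hu.1
      obtain ⟨a, ha, haD⟩ := hout A hA
      obtain ⟨b, hb, hbD⟩ := hout B hB
      exact mem_biUnion.2 ⟨(a, b), mem_product.2 ⟨ha, hb⟩,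
        mem_filter.2 ⟨hD, insert_subset haD (insert_subset hbD hSsub)⟩⟩
    refine (card_le_card hsub).trans ((card_biUnion_le_card_mul _ _ 3 fun p hp => ?_).trans ?_)
    · obtain ⟨hp1, hp2⟩ := mem_product.1 hp
      rw [mem_sdiff] at hp1 hp2
      refine hdeg _ ?_
      rw [card_insert_of_notMem, card_insert_of_notMem fun h => hp2.2 (mem_erase.1 h).2, hse, hSc]
      rw [mem_insert]
      rintro (h | h)
      · exact hp1.2 (mem_inter.2 ⟨hp1.1, h ▸ hp2.1⟩)
      · exact hp1.2 (mem_erase.1 h).2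
    · rw [card_product, hAS, hBS]
  have hsub : G ⊆ (G.filter fun D => S ⊆ D) ∪ S.biUnion fun s => G.filter fun D => s ∉ D := by
    intro D hD
    by_cases h : S ⊆ D
    · exact mem_union_left _ (mem_filter.2 ⟨hD, h⟩)
    · obtain ⟨s, hs, hsD⟩ := not_subset.1 h
      exact mem_union_right _ (mem_biUnion.2 ⟨s, hs, mem_filter.2 ⟨hD, hsD⟩⟩)
  have h1 := (card_le_card hsub).trans (card_union_le _ _)
  have h2 := card_biUnion_le_card_mul S (fun s => G.filter fun D => s ∉ D) 12 hmiss
  omega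

/-! ### Comparison of sizes and conclusion -/

theorem isMaximalNontrivialFamily_H {l : ℕ} (hd : 3 ≤ d) (hdk : d ≤ k) (hl : 2 ≤ l)
    (hlk : l + d ≤ k + 2) (hn : 2 * k + 1 ≤ n) :
    IsMaximalNontrivialFamily k d (H n k d l) := by
  have hK : (interval n 1 (d - 1)).card = d - 1 := by
    rw [card_interval le_rfl (by omega)]; omega
  have hX : (interval n d (d + l - 1)).card = l := by
    rw [card_interval (by omega) (by omega)]; omega
  rw [H_eq_hFamily hd (by omega)]
  exact isMaximalNontrivialFamily_hFamily (disjoint_interval _ _ _ _ (by omega)) hd (by omega)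
    (by omega) (by omega) hdk hn

theorem add_two_mul_le_n₂ {r : ℕ} (hd : 3 ≤ d) (hr : 2 ≤ r) :
    d + 2 * r * (d + r) ^ (d + 1) ≤ n₂ (d + r) d := by
  rw [n₂, if_neg (by omega), Nat.add_sub_cancel_left]
  set k := d + r with hk
  have h1 : k ≤ k ^ r - 1 := by
    have h2 : k ^ 2 ≤ k ^ r := Nat.pow_le_pow_right (by omega) hr
    have h3 : k + 1 ≤ k ^ 2 := by nlinarith
    omega
  have h2 : k ^ (d + 1) ≤ (k ^ r - 1) ^ k :=
    (Nat.pow_le_pow_right (by omega) (by omega)).trans (Nat.pow_le_pow_left h1 k)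
  have h3 : 1 ≤ Nat.factorial k := Nat.factorial_pos k
  have h4 : r ≤ r ^ 2 := by nlinarith
  calc d + 2 * r * k ^ (d + 1) = d + 2 * r * k ^ (d + 1) * 1 := by ring
    _ ≤ d + 2 * r ^ 2 * (k ^ r - 1) ^ k * Nat.factorial k := by gcongr

theorem isomorphic_or_card_lt_of_eq_succ (hd : 3 ≤ d) (hn : (d + 1) ^ 2 < n)
    (hG : IsMaximalNontrivialFamily (d + 1) d G) :
    Isomorphic G (H n (d + 1) d 2) ∨ Isomorphic G (H n (d + 1) d 3) ∨
      G.card < (H n (d + 1) d 3).card := by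
  have hn' : d * d + 2 * d + 2 ≤ n := by nlinarith
  have hdd : 3 * d ≤ d * d := Nat.mul_le_mul_right d hd
  have h := hG.isomorphic_or_card_covers_le hd (by omega) (by omega)
  rw [Nat.add_sub_cancel_left] at h
  rcases h with h | h | h | h
  · exact Or.inl h
  · exact Or.inl h
  · exact Or.inr (Or.inl h)
  · right; right
    have h1 := mul_choose_le_card_H (n := n) (N := n + 1 - d) (r := 1) (l := 3) hd (by omega)
      (by omega) (by omega) (by omega)
    rw [Nat.choose_one_right] at h1
    refine lt_of_lt_of_le ?_ h1
    rcases Nat.le_one_iff_eq_zero_or_eq_one.1 h with h | h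
    · have := hG.1.card_le_of_covers_eq_empty hd (card_eq_zero.1 h)
      omega
    · obtain ⟨T, hT⟩ := card_eq_one.1 h
      have := hG.1.card_le_of_covers_eq_singleton hd hT
      omega

/-- The largest and the second largest families, with `r = k - d`. -/
theorem isLargest_iff_and_isSecondLargest_iff {r : ℕ} (hd : 3 ≤ d) (hr : 1 ≤ r)
    (hn : n₂ (d + r) d < n) (F : Finset (Finset (Fin n))) :
    (r + 1 ≤ d → (IsLargest (IsNontrivialFamily (d + r) d) F ↔ Isomorphic F (H n (d + r) d 2)) ∧
      (IsSecondLargest (IsMaximalNontrivialFamily (d + r) d) F ↔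
        Isomorphic F (H n (d + r) d (r + 2)))) ∧
    (r = d → (IsLargest (IsNontrivialFamily (d + r) d) F ↔
        Isomorphic F (H n (d + r) d (r + 2))) ∧
      (IsSecondLargest (IsMaximalNontrivialFamily (d + r) d) F ↔
        Isomorphic F (H n (d + r) d 2))) ∧
    (d + 1 ≤ r → (IsLargest (IsNontrivialFamily (d + r) d) F ↔
        Isomorphic F (H n (d + r) d (r + 2))) ∧
      (IsSecondLargest (IsMaximalNontrivialFamily (d + r) d) F ↔
        Isomorphic F (H n (d + r) d (r + 1)))) := by
  rcases hr.eq_or_lt with rfl | hr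
  · rw [n₂, if_pos rfl] at hn
    have hn' : d * d + 2 * d + 2 ≤ n := by nlinarith
    have hdd : 3 * d ≤ d * d := Nat.mul_le_mul_right d hd
    refine ⟨fun _ => ?_, fun h => by omega, fun h => by omega⟩
    exact largest_and_secondLargest
      (isMaximalNontrivialFamily_H hd (by omega) (by omega) (by omega) (by omega))
      (isMaximalNontrivialFamily_H hd (by omega) (by omega) (by omega) (by omega))
      (card_H_lt_card_H_two (N := n + 1 - d) hd (by omega) (by omega) (by omega) (by omega)
        (by omega))
      (fun G hG => isomorphic_or_card_lt_of_eq_succ hd hn hG) F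
  have hn₂ := (add_two_mul_le_n₂ hd hr).trans_lt hn
  set k := d + r with hk
  have hn' : 2 * k + 1 ≤ n := by
    have h1 : k ^ 1 ≤ k ^ (d + 1) := Nat.pow_le_pow_right (by omega) (by omega)
    have h2 : 2 * 1 * k ^ 1 ≤ 2 * r * k ^ (d + 1) := by gcongr
    rw [pow_one] at h2
    omega
  obtain ⟨N, hN⟩ : ∃ N, n + 1 = N + d := ⟨n + 1 - d, by omega⟩
  have hN1 : n - d = N - 1 := by omega
  have hN2 : n - d - 1 = N - 2 := by omega
  -- the upper estimate for families with leading coefficient `c`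
  let U : ℕ → ℕ := fun c => c * (N - 1).choose r + k ^ (d + 1) * (N - 2).choose (r - 1)
  have hU : ∀ c c', c < c' → c + 1 ≤ k → U c < c' * (N - r - 2).choose r := fun c c' h1 h2 =>
    mul_choose_add_lt hr hd h1 h2 (by rw [← hk]; omega) (by omega)
  have hlow : ∀ l, 1 ≤ l → l ≤ r + 2 → l * (N - r - 2).choose r ≤ (H n k d l).card := by
    intro l h1 h2
    refine (Nat.mul_le_mul_left l ?_).trans (mul_choose_le_card_H hd h1 h2 (by omega) hN)
    exact Nat.choose_le_choose _ (by omega)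
  have hlow2 : (d + 1) * (N - r - 2).choose r ≤ (H n k d 2).card := by
    refine (Nat.mul_le_mul_left _ ?_).trans (mul_choose_le_card_H_two hd (by omega) hN)
    exact Nat.choose_le_choose _ (by omega)
  have hup : (H n k d (r + 1)).card ≤ U (r + 1) := by
    refine (card_H_le hd (by omega) (by omega) (by omega) hN).trans (Nat.add_le_add_left ?_ _)
    refine Nat.mul_le_mul_right _ ?_
    calc d - 1 ≤ k := by omega
      _ = k ^ 1 := (pow_one k).symm
      _ ≤ k ^ (d + 1) := Nat.pow_le_pow_right (by omega) (by omega)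
  have hup2 : (H n k d 2).card ≤ U (d + 1) :=
    (card_H_two_le hd (by omega) hN).trans (Nat.le_add_right _ _)
  have hmax : ∀ l, 2 ≤ l → l ≤ r + 2 → IsMaximalNontrivialFamily k d (H n k d l) :=
    fun l h1 h2 => isMaximalNontrivialFamily_H hd (by omega) h1 (by omega) hn'
  have hstr : ∀ G : Finset (Finset (Fin n)), IsMaximalNontrivialFamily k d G →
      Isomorphic G (H n k d 2) ∨ Isomorphic G (H n k d (r + 1)) ∨
        Isomorphic G (H n k d (r + 2)) ∨ G.card ≤ U r := by
    intro G hG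
    have h := hG.isomorphic_or_card_covers_le hd (by omega) hn'
    rw [show k - d = r by omega] at h
    rcases h with h | h | h | h
    · exact Or.inl h
    · exact Or.inr (Or.inl h)
    · exact Or.inr (Or.inr (Or.inl h))
    · refine Or.inr (Or.inr (Or.inr ?_))
      have h1 := hG.1.card_le hd (by omega)
      rw [hN2, hN1, show k - d = r by omega] at h1
      exact h1.trans (Nat.add_le_add_right (Nat.mul_le_mul_right _ h) _)
  have hUmono : U r ≤ U (r + 1) :=
    Nat.add_le_add_right (Nat.mul_le_mul_right _ (by omega)) _
  refine ⟨fun hrd => ?_, fun hrd => ?_, fun hrd => ?_⟩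
  · refine largest_and_secondLargest (hmax 2 le_rfl (by omega)) (hmax (r + 2) (by omega) le_rfl)
      (card_H_lt_card_H_two hd (by omega) (by omega) (by omega) (by omega) hN) ?_ F
    intro G hG
    have h1 := hU (r + 1) (r + 2) (by omega) (by omega)
    have h2 := hlow (r + 2) (by omega) le_rfl
    rcases hstr G hG with h | h | h | h
    · exact Or.inl h
    · have := h.card_eq
      omega
    · exact Or.inr (Or.inl h)
    · omega
  · have h0 := hU (d + 1) (r + 2) (by omega) (by omega)
    have h2 := hlow (r + 2) (by omega) le_rfl
    refine largest_and_secondLargest (hmax (r + 2) (by omega) le_rfl) (hmax 2 le_rfl (by omega))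
      (by omega) ?_ F
    intro G hG
    rcases hstr G hG with h | h | h | h
    · exact Or.inr (Or.inl h)
    · have h3 := h.card_eq
      have h4 := card_H_lt_card_H_two (N := N) (r := r) (l := r + 1) hd (by omega) (by omega)
        (by omega) (by omega) hN
      rw [← hk] at h4
      omega
    · exact Or.inl h
    · have h3 := hU r (d + 1) (by omega) (by omega)
      omega
  · have h0 := hU (r + 1) (r + 2) (by omega) (by omega)
    have h2 := hlow (r + 2) (by omega) le_rfl
    refine largest_and_secondLargest (hmax (r + 2) (by omega) le_rfl)
      (hmax (r + 1) (by omega) (by omega)) (by omega) ?_ F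
    have h3 := hlow (r + 1) (by omega) (by omega)
    intro G hG
    rcases hstr G hG with h | h | h | h
    · have h4 := hU (d + 1) (r + 1) (by omega) (by omega)
      have := h.card_eq
      omega
    · exact Or.inr (Or.inl h)
    · exact Or.inl h
    · have h4 := hU r (r + 1) (by omega) (by omega)
      omega

end DWise

theorem mainTheorem3 (k d n : ℕ) (hd : 3 ≤ d) (hk : d < k) (hn : DWise.n₂ k d < n) :
    (∀ F : Finset (Finset (Fin n)),
      (k ≤ 2 * d - 1 →
        (DWise.IsLargest (DWise.IsNontrivialFamily k d) F ↔
          DWise.Isomorphic F (DWise.H n k d 2))) ∧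
      (2 * d ≤ k →
        (DWise.IsLargest (DWise.IsNontrivialFamily k d) F ↔
          DWise.Isomorphic F (DWise.H n k d (k - d + 2))))) ∧
    (∀ F : Finset (Finset (Fin n)),
      (k ≤ 2 * d - 1 →
        (DWise.IsSecondLargest (DWise.IsMaximalNontrivialFamily k d) F ↔
          DWise.Isomorphic F (DWise.H n k d (k - d + 2)))) ∧
      (k = 2 * d →
        (DWise.IsSecondLargest (DWise.IsMaximalNontrivialFamily k d) F ↔
          DWise.Isomorphic F (DWise.H n k d 2))) ∧
      (2 * d + 1 ≤ k →
        (DWise.IsSecondLargest (DWise.IsMaximalNontrivialFamily k d) F ↔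
          DWise.Isomorphic F (DWise.H n k d (k - d + 1))))) := by
  obtain ⟨r, rfl⟩ := Nat.exists_eq_add_of_le hk.le
  have key := fun F => DWise.isLargest_iff_and_isSecondLargest_iff hd (by omega : 1 ≤ r) hn F
  rw [Nat.add_sub_cancel_left]
  refine ⟨fun F => ⟨fun h => ((key F).1 (by omega)).1, fun h => ?_⟩, fun F =>
    ⟨fun h => ((key F).1 (by omega)).2, fun h => ((key F).2.1 (by omega)).2,
      fun h => ((key F).2.2 (by omega)).2⟩⟩
  rcases (by omega : r = d ∨ d + 1 ≤ r) with h' | h'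
  · exact ((key F).2.1 h').1
  · exact ((key F).2.2 h').1
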